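/- Let $d\in\mathbb N$, $0<s_1<s_2$. Let $V$ be a reproducing kernel Hilbert space of vector fields on $\mathbb R^d$, continuously embedded in $C^1_0(\mathbb R^d,\mathbb R^d)$ (the $C^1$ fields that tend to $0$ at infinity together with their differential, with $\|w\|_{1,\infty}$ the largest supremum norm of $w$ and $dw$). For each $\lambda\in[s_1,s_2]$ let $W_\lambda$ be a reproducing kernel Hilbert space of vector fields on $\mathbb R^d$, with norm $\|\cdot\|_\lambda$, such that $W_\lambda\hookrightarrow W_\mu\hookrightarrow V$ for $\mu<\lambda$ in $[s_1,s_2]$, all these embeddings (including those into $V$) having norms bounded by one constant $C<\infty$. Let $\rho$ be a positive (in particular nonzero) Borel measure on $[s_1,s_2]$. Assume that the norms depend measurably on the scale: for $\nu=\rho$ and for $\nu$ the Lebesgue measure, $\lambda\mapsto\|u(\lambda)\|_\lambda$ is $\nu$-measurable for every strongly measurable $u:[s_1,s_2]\to V$ with $u(\lambda)\in W_\lambda$ for $\nu$-a.e. $\lambda$. Let $\mathbb W$ be the space of all $v\in H^1((s_1,s_2),V)$, identified with their continuous versions $v:[s_1,s_2]\to V$ and with weak derivative $\partial_\lambda v$,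 such that $v(\lambda)\in W_\lambda$ for $\rho$-a.e. $\lambda$, $\partial_\lambda v(\lambda)\in W_\lambda$ for Lebesgue-a.e. $\lambda$, and $$\|v\|_{\mathbb W}^2=\int_{[s_1,s_2]}\|v(\lambda)\|_\lambda^2\,d\rho(\lambda)+\int_{s_1}^{s_2}\|\partial_\lambda v(\lambda)\|_\lambda^2\,d\lambda<\infty,$$ with this norm and the corresponding inner product. Write $v(\lambda,x)=v(\lambda)(x)$. For every $v\in L^2([0,1],\mathbb W)$ there is a unique map $\phi=\phi(\cdot,\cdot,\cdot;v):[0,1]\times[s_1,s_2]\times\mathbb R^d\to\mathbb R^d$ such that, for all $t,\lambda,x$, $$\phi(t,\lambda,x)=x+\int_0^t v(\tau,\lambda,\phi(\tau,\lambda,x))\,d\tau$$ (with integrable integrand on $[0,1]$). Moreover: 1. If $(v_n)$ is a bounded sequence in $L^2([0,1],\mathbb W)$ converging weakly to $v\in L^2([0,1],\mathbb W)$, then $\phi(\cdot,\cdot,\cdot;v_n)\to\phi(\cdot,\cdot,\cdot;v)$ uniformly on $[0,1]\times[s_1,s_2]\times K$ for every compact $K\subset\mathbb R^d$. 2. Let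 $G$ be a real-valued function of maps $[s_1,s_2]\times\mathbb R^d\to\mathbb R^d$ which, on the set of end maps $\{\phi(1,\cdot,\cdot;v): v\in L^2([0,1],\mathbb W)\}$, is bounded below and lower semicontinuous for uniform convergence on compact sets. Then the objective $$v\mapsto\frac12\int_0^1\|v(t)\|_{\mathbb W}^2\,dt+G(\phi(1,\cdot,\cdot;v))$$ attains its minimum on $L^2([0,1],\mathbb W)$. -/

import Mathlib

open MeasureTheory Filter Topology Set
open scoped ContDiff UniformConvergence InnerProductSpace

noncomputable section

/-- The Euclidean space `ℝ^d`. -/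
abbrev Vec (d : ℕ) := EuclideanSpace ℝ (Fin d)

/-- Lebesgue measure on the scale interval `[s₁, s₂]`. -/
abbrev lebesgue (s₁ s₂ : ℝ) : Measure (Icc s₁ s₂) :=
  (volume : Measure ℝ).comap Subtype.val

section Scale

variable {d : ℕ} {s₁ s₂ : ℝ}
  (V : Type*) [NormedAddCommGroup V] [InnerProductSpace ℝ V] [RKHS ℝ V (Vec d) (Vec d)]

/-- `V` is continuously embedded in `C¹₀(ℝ^d, ℝ^d)`: its elements are `C¹` vector fields which
tend to zero at infinity together with their differential, and `‖v‖_{1,∞} ≤ C ‖v‖_V`. -/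
def EmbedsInC10 : Prop :=
  ∃ C : ℝ, ∀ v : V, ContDiff ℝ 1 (v : Vec d → Vec d) ∧
    Tendsto (v : Vec d → Vec d) (cocompact (Vec d)) (𝓝 0) ∧
    Tendsto (fderiv ℝ (v : Vec d → Vec d)) (cocompact (Vec d)) (𝓝 0) ∧
    ∀ x, ‖v x‖ ≤ C * ‖v‖ ∧ ‖fderiv ℝ (v : Vec d → Vec d) x‖ ≤ C * ‖v‖

variable (W : Icc s₁ s₂ → Type*) [∀ s, NormedAddCommGroup (W s)]
  [∀ s, InnerProductSpace ℝ (W s)] [∀ s, RKHS ℝ (W s) (Vec d) (Vec d)]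

/-- `W_s ↪ W_r ↪ V` for all scales `r < s` in `[s₁, s₂]` (as spaces of functions), with embedding
constants bounded by one and the same `C`. -/
def NestedEmbeddings : Prop :=
  ∃ C : ℝ,
    (∀ (s : Icc s₁ s₂) (w : W s), ∃ v : V, (v : Vec d → Vec d) = w ∧ ‖v‖ ≤ C * ‖w‖) ∧
    (∀ r s : Icc s₁ s₂, r < s → ∀ w : W s, ∃ w' : W r,
      (w' : Vec d → Vec d) = w ∧ ‖w'‖ ≤ C * ‖w‖)

/-- The elements of `V` which, as functions, belong to `W_s`. -/
def scaleSubspace (s : Icc s₁ s₂) : Submodule ℝ V where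
  carrier := {u | ∃ w : W s, (w : Vec d → Vec d) = u}
  add_mem' := by
    rintro a b ⟨w, hw⟩ ⟨w', hw'⟩
    exact ⟨w + w', by simp [hw, hw']⟩
  zero_mem' := ⟨0, by simp⟩
  smul_mem' := by
    rintro c a ⟨w, hw⟩
    exact ⟨c • w, by simp [hw]⟩

variable {V}

open Classical in
/-- A function `u ∈ V` regarded as an element of `W_s`, if it belongs to `W_s`
(and `0` otherwise). In particular `‖toScale W s u‖` is the norm `‖u‖_s` of `u ∈ V ∩ W_s`. -/
def toScale (s : Icc s₁ s₂) (u : V) : W s :=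
  if h : ∃ w : W s, (w : Vec d → Vec d) = u then h.choose else 0

variable {W} in
lemma toScale_eq {s : Icc s₁ s₂} {u : V} {w : W s} (h : (w : Vec d → Vec d) = u) :
    toScale W s u = w := by
  have h' : ∃ w : W s, (w : Vec d → Vec d) = u := ⟨w, h⟩
  rw [toScale, dif_pos h']
  exact DFunLike.coe_injective (h'.choose_spec.trans h.symm)

variable {W} in
lemma coe_toScale {s : Icc s₁ s₂} {u : V} (h : u ∈ scaleSubspace V W s) :
    (toScale W s u : Vec d → Vec d) = u := by
  obtain ⟨w, hw⟩ := h
  rw [toScale_eq hw, hw]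

variable {W} in
lemma toScale_add {s : Icc s₁ s₂} {u u' : V} (h : u ∈ scaleSubspace V W s)
    (h' : u' ∈ scaleSubspace V W s) :
    toScale W s (u + u') = toScale W s u + toScale W s u' :=
  toScale_eq (by simp [coe_toScale h, coe_toScale h'])

variable {W} in
lemma toScale_smul {s : Icc s₁ s₂} {u : V} (c : ℝ) (h : u ∈ scaleSubspace V W s) :
    toScale W s (c • u) = c • toScale W s u :=
  toScale_eq (by simp [coe_toScale h])

lemma toScale_zero (s : Icc s₁ s₂) : toScale W s (0 : V) = 0 :=
  toScale_eq (by simp)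

variable {W} in
lemma eq_zero_of_toScale {s : Icc s₁ s₂} {u : V} (h : u ∈ scaleSubspace V W s)
    (h0 : toScale W s u = 0) : u = 0 := by
  apply DFunLike.coe_injective
  rw [← coe_toScale h, h0]
  simp

variable (V) in
/-- With respect to the measure `ν` on `[s₁, s₂]`, the norms `‖·‖_s` depend measurably on the scale:
`s ↦ ‖u(s)‖_s` is measurable for every measurable `u : [s₁, s₂] → V` with `u(s) ∈ W_s` a.e. -/
def MeasurableNorms (ν : Measure (Icc s₁ s₂)) : Prop :=
  ∀ u : Icc s₁ s₂ → V, StronglyMeasurable u → (∀ᵐ s ∂ν, u s ∈ scaleSubspace V W s) →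
    AEStronglyMeasurable (fun s => ‖toScale W s (u s)‖) ν

variable (V) in
/-- The data of the multiscale construction: a Hilbert space `V ↪ C¹₀(ℝ^d, ℝ^d)`, a nested family
`W_s ↪ V`, `s ∈ [s₁, s₂]`, with uniformly bounded embedding constants, and a positive (i.e. nonzero)
measure `ρ` on `[s₁, s₂]`; the norms of `W_s` depend measurably on `s`, so that the integrals
defining the norm of the multiscale space make sense. -/
class MultiscaleFamily (ρ : Measure (Icc s₁ s₂)) : Prop where
  embeds : EmbedsInC10 V
  nested : NestedEmbeddings V W
  ne_zero : ρ ≠ 0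
  measurable_rho : MeasurableNorms V W ρ
  measurable_lebesgue : MeasurableNorms V W (lebesgue s₁ s₂)

end Scale

section WeakDerivative

variable {s₁ s₂ : ℝ} {V : Type*} [NormedAddCommGroup V] [InnerProductSpace ℝ V]

/-- `g` is a weak derivative of `v` on the open interval `(s₁, s₂)`
(the end points are Lebesgue-negligible). -/
def HasWeakDeriv (v g : Icc s₁ s₂ → V) : Prop :=
  ∀ φ : ℝ → ℝ, ContDiff ℝ ∞ φ → HasCompactSupport φ → tsupport φ ⊆ Ioo s₁ s₂ →
    ∫ s, φ s • g s ∂(lebesgue s₁ s₂) = -∫ s, deriv φ s • v s ∂(lebesgue s₁ s₂)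

lemma integral_lebesgue {f : ℝ → V} (hf : ∀ x ∉ Icc s₁ s₂, f x = 0) :
    ∫ s : Icc s₁ s₂, f s ∂(lebesgue s₁ s₂) = ∫ x, f x := by
  rw [lebesgue, integral_subtype_comap measurableSet_Icc f]
  exact setIntegral_eq_integral_of_forall_compl_eq_zero hf

/-- A smooth function with compact support in `(s₁, s₂)` and zero integral is the derivative of
a smooth function with compact support in `(s₁, s₂)`. -/
lemma exists_primitive {η : ℝ → ℝ} (hη : ContDiff ℝ ∞ η) (hc : HasCompactSupport η)
    (hs : tsupport η ⊆ Ioo s₁ s₂) (h0 : ∫ x, η x = 0) :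
    ∃ φ : ℝ → ℝ, ContDiff ℝ ∞ φ ∧ HasCompactSupport φ ∧ tsupport φ ⊆ Ioo s₁ s₂ ∧
      deriv φ = η := by
  rcases (tsupport η).eq_empty_or_nonempty with he | hne
  · have : η = 0 := by
      rw [← tsupport_eq_empty_iff]; exact he
    exact ⟨0, contDiff_const, HasCompactSupport.zero, by simp, by rw [this]; ext; simp⟩
  have hK : IsCompact (tsupport η) := hc
  set a := sInf (tsupport η)
  set b := sSup (tsupport η)
  have ha : a ∈ Ioo s₁ s₂ := hs (hK.sInf_mem hne)
  have hb : b ∈ Ioo s₁ s₂ := hs (hK.sSup_mem hne)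
  have hz : ∀ x, x ∉ Icc a b → η x = 0 := by
    intro x hx
    by_contra h
    have hx' : x ∈ tsupport η := subset_tsupport _ h
    exact hx ⟨csInf_le hK.bddBelow hx', le_csSup hK.bddAbove hx'⟩
  have hcont : Continuous η := hη.continuous
  have hd : ∀ x, HasDerivAt (fun x => ∫ y in s₁..x, η y) (η x) x := fun x =>
    intervalIntegral.integral_hasDerivAt_right (hcont.intervalIntegrable _ _)
      (hcont.stronglyMeasurableAtFilter _ _) hcont.continuousAt
  have hderiv : deriv (fun x => ∫ y in s₁..x, η y) = η := funext fun x => (hd x).deriv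
  have hsupp : tsupport (fun x => ∫ y in s₁..x, η y) ⊆ Icc a b := by
    refine closure_minimal ?_ isClosed_Icc
    intro x hx
    by_contra hxn
    apply hx
    rw [mem_Icc, not_and_or, not_le, not_le] at hxn
    rcases hxn with hxa | hxb
    · apply intervalIntegral.integral_zero_ae
      refine Eventually.of_forall fun y hy => hz y fun hy' => ?_
      have h1 : y ≤ max s₁ x := hy.2
      have h2 : max s₁ x < a := max_lt ha.1 hxa
      linarith [hy'.1]
    · have hsx : s₁ ≤ x := by linarith [hb.1]
      show ∫ y in s₁..x, η y = 0
      rw [intervalIntegral.integral_of_le hsx,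
        setIntegral_eq_integral_of_forall_compl_eq_zero, h0]
      intro y hy
      refine hz y fun hy' => hy ⟨by linarith [ha.1, hy'.1], by linarith [hy'.2]⟩
  refine ⟨fun x => ∫ y in s₁..x, η y, ?_, ?_, ?_, hderiv⟩
  · rw [contDiff_infty_iff_deriv, hderiv]
    exact ⟨fun x => (hd x).differentiableAt, hη⟩
  · exact isCompact_Icc.of_isClosed_subset (isClosed_tsupport _) hsupp
  · exact hsupp.trans (Icc_subset_Ioo ha.1 hb.2)

/-- A continuous function whose weak derivative is zero is constant. -/
lemma HasWeakDeriv.const [CompleteSpace V] {v : C(Icc s₁ s₂, V)} {g : Icc s₁ s₂ → V}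
    (h : HasWeakDeriv v g) (hg : g =ᵐ[lebesgue s₁ s₂] 0) (r s : Icc s₁ s₂) : v r = v s := by
  rcases eq_or_ne s₁ s₂ with heq | hne
  · have : r = s := Subtype.ext (by
      have h1 := r.2; have h2 := s.2
      linarith [h1.1, h1.2, h2.1, h2.2])
    rw [this]
  have hlt : s₁ < s₂ := lt_of_le_of_ne (r.2.1.trans r.2.2) hne
  set f : ℝ → V := IccExtend hlt.le v with hf
  have hfc : Continuous f := v.continuous.Icc_extend'
  have hfv : ∀ s : Icc s₁ s₂, f s = v s := fun s => IccExtend_val _ _ _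
  have hzero : ∀ η : ℝ → ℝ, ContDiff ℝ ∞ η → HasCompactSupport η → tsupport η ⊆ Ioo s₁ s₂ →
      ∫ x, η x = 0 → ∫ x, η x • f x = 0 := by
    intro η h1 h2 h3 h4
    obtain ⟨φ, hφ1, hφ2, hφ3, hφ4⟩ := exists_primitive h1 h2 h3 h4
    have h5 := h φ hφ1 hφ2 hφ3
    have h6 : ∫ s, φ s • g s ∂(lebesgue s₁ s₂) = 0 := by
      apply integral_eq_zero_of_ae
      filter_upwards [hg] with s hs
      simp [hs]
    rw [h6, hφ4, eq_comm, neg_eq_zero] at h5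
    rw [← integral_lebesgue (s₁ := s₁) (s₂ := s₂) (f := fun x => η x • f x)]
    · simpa only [hfv] using h5
    · intro x hx
      have : η x = 0 := by
        by_contra hne'
        exact hx (Ioo_subset_Icc_self (h3 (subset_tsupport _ hne')))
      simp [this]
  -- a bump function with unit integral
  let ψb : ContDiffBump ((s₁ + s₂) / 2) := ⟨(s₂ - s₁) / 8, (s₂ - s₁) / 4, by linarith, by linarith⟩
  set ψ : ℝ → ℝ := ψb.normed volume with hψ
  have hψ1 : ContDiff ℝ ∞ ψ := ψb.contDiff_normed
  have hψ2 : HasCompactSupport ψ := ψb.hasCompactSupport_normed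
  have hψ3 : tsupport ψ ⊆ Ioo s₁ s₂ := by
    rw [hψ, ψb.tsupport_normed_eq, Real.closedBall_eq_Icc]
    apply Icc_subset_Ioo <;> simp only [ψb] <;> linarith
  have hψ4 : ∫ x, ψ x = 1 := ψb.integral_normed
  have hint : ∀ η : ℝ → ℝ, ContDiff ℝ ∞ η → HasCompactSupport η →
      Integrable (fun x => η x • f x) := fun η h1 h2 =>
    (h1.continuous.smul hfc).integrable_of_hasCompactSupport h2.smul_right
  set c : V := ∫ x, ψ x • f x with hcdef
  have hae : ∀ᵐ x, x ∈ Ioo s₁ s₂ → f x - c = 0 := by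
    apply isOpen_Ioo.ae_eq_zero_of_integral_contDiff_smul_eq_zero
    · exact (hfc.sub continuous_const).locallyIntegrable.locallyIntegrableOn _
    intro η h1 h2 h3
    have hηi : Integrable η := h1.continuous.integrable_of_hasCompactSupport h2
    have hψi : Integrable ψ := hψ1.continuous.integrable_of_hasCompactSupport hψ2
    have key := hzero (fun x => η x - (∫ y, η y) * ψ x) (h1.sub (contDiff_const.mul hψ1))
      (h2.sub (hψ2.mul_left (f := fun _ => ∫ y, η y)))
      (by
        refine (tsupport_sub η (fun x => (∫ y, η y) * ψ x)).trans (union_subset h3 ?_)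
        exact (tsupport_mul_subset_right (f := fun _ => ∫ y, η y)).trans hψ3)
      (by
        rw [integral_sub hηi (hψi.const_mul _), integral_const_mul, hψ4]; ring)
    have e1 : ∀ x, (η x - (∫ y, η y) * ψ x) • f x
        = η x • f x - (∫ y, η y) • (ψ x • f x) := fun x => by
      rw [sub_smul, mul_smul]
    simp only [e1] at key
    have hi2 : Integrable (fun x => (∫ y, η y) • (ψ x • f x)) := (hint ψ hψ1 hψ2).smul _
    rw [integral_sub (hint η h1 h2) hi2, integral_smul, sub_eq_zero] at key
    simp only [smul_sub]
    rw [integral_sub (hint η h1 h2) (hηi.smul_const c), key, integral_smul_const, sub_self]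
  have hEq : EqOn f (fun _ => c) (Icc s₁ s₂) := by
    apply Measure.eqOn_Icc_of_ae_eq volume hne _ hfc.continuousOn continuousOn_const
    rw [← restrict_Ioo_eq_restrict_Icc]
    rw [Filter.EventuallyEq, ae_restrict_iff' measurableSet_Ioo]
    filter_upwards [hae] with x hx hx'
    exact sub_eq_zero.mp (hx hx')
  rw [← hfv, ← hfv, hEq r.2, hEq s.2]

end WeakDerivative

section MultiscaleSpace

variable {d : ℕ} {s₁ s₂ : ℝ}
  (V : Type*) [NormedAddCommGroup V] [InnerProductSpace ℝ V] [RKHS ℝ V (Vec d) (Vec d)]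
  (W : Icc s₁ s₂ → Type*) [∀ s, NormedAddCommGroup (W s)]
  [∀ s, InnerProductSpace ℝ (W s)] [∀ s, RKHS ℝ (W s) (Vec d) (Vec d)]

/-- For the measure `ν` on `[s₁, s₂]`: `u(s) ∈ W_s` for `ν`-a.e. `s`, and `∫ ‖u(s)‖_s² dν(s) < ∞`. -/
def ScaleSquareIntegrable (ν : Measure (Icc s₁ s₂)) (u : Icc s₁ s₂ → V) : Prop :=
  (∀ᵐ s ∂ν, u s ∈ scaleSubspace V W s) ∧ Integrable (fun s => ‖toScale W s (u s)‖ ^ 2) ν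

/-- `∫ ⟨u(s), u'(s)⟩_s dν(s)`. -/
def scaleInner (ν : Measure (Icc s₁ s₂)) (u u' : Icc s₁ s₂ → V) : ℝ :=
  ∫ s, ⟪toScale W s (u s), toScale W s (u' s)⟫_ℝ ∂ν

variable {V W}

lemma ScaleSquareIntegrable.congr {ν : Measure (Icc s₁ s₂)} {u u' : Icc s₁ s₂ → V}
    (h : ScaleSquareIntegrable V W ν u) (he : u =ᵐ[ν] u') : ScaleSquareIntegrable V W ν u' := by
  refine ⟨?_, h.2.congr ?_⟩
  · filter_upwards [h.1, he] with s h1 h2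
    rwa [← h2]
  · filter_upwards [he] with s h2
    rw [h2]

lemma scaleInner_congr {ν : Measure (Icc s₁ s₂)} {u₁ u₁' u₂ u₂' : Icc s₁ s₂ → V}
    (h₁ : u₁ =ᵐ[ν] u₁') (h₂ : u₂ =ᵐ[ν] u₂') :
    scaleInner V W ν u₁ u₂ = scaleInner V W ν u₁' u₂' := by
  apply integral_congr_ae
  filter_upwards [h₁, h₂] with s h1 h2
  rw [h1, h2]

lemma ScaleSquareIntegrable.add {ν : Measure (Icc s₁ s₂)} (hν : MeasurableNorms V W ν)
    {u u' : Icc s₁ s₂ → V} (hu : StronglyMeasurable u) (hu' : StronglyMeasurable u')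
    (h : ScaleSquareIntegrable V W ν u) (h' : ScaleSquareIntegrable V W ν u') :
    ScaleSquareIntegrable V W ν (u + u') := by
  have hm : ∀ᵐ s ∂ν, (u + u') s ∈ scaleSubspace V W s := by
    filter_upwards [h.1, h'.1] with s h1 h2 using Submodule.add_mem _ h1 h2
  refine ⟨hm, Integrable.mono' ((h.2.add h'.2).const_mul 2) ((hν _ (hu.add hu') hm).pow 2) ?_⟩
  filter_upwards [h.1, h'.1] with s h1 h2
  simp only [Pi.add_apply]
  rw [toScale_add h1 h2, Real.norm_of_nonneg (by positivity)]
  have := norm_add_le (toScale W s (u s)) (toScale W s (u' s))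
  nlinarith [norm_nonneg (toScale W s (u s) + toScale W s (u' s)),
    sq_nonneg (‖toScale W s (u s)‖ - ‖toScale W s (u' s)‖)]

lemma ScaleSquareIntegrable.smul {ν : Measure (Icc s₁ s₂)} {u : Icc s₁ s₂ → V} (c : ℝ)
    (h : ScaleSquareIntegrable V W ν u) : ScaleSquareIntegrable V W ν (c • u) := by
  refine ⟨?_, (h.2.const_mul (c ^ 2)).congr ?_⟩
  · filter_upwards [h.1] with s h1 using Submodule.smul_mem _ c h1
  · filter_upwards [h.1] with s h1
    simp only [Pi.smul_apply]
    rw [toScale_smul c h1, norm_smul, mul_pow, Real.norm_eq_abs, sq_abs]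

lemma ScaleSquareIntegrable.zero {ν : Measure (Icc s₁ s₂)} :
    ScaleSquareIntegrable V W ν (0 : Icc s₁ s₂ → V) := by
  refine ⟨Eventually.of_forall fun s => Submodule.zero_mem _, ?_⟩
  simp [toScale_zero]

/-- Integrability of `s ↦ ⟨u(s), u'(s)⟩_s`. -/
lemma ScaleSquareIntegrable.integrable_inner {ν : Measure (Icc s₁ s₂)}
    (hν : MeasurableNorms V W ν) {u u' : Icc s₁ s₂ → V} (hu : StronglyMeasurable u)
    (hu' : StronglyMeasurable u') (h : ScaleSquareIntegrable V W ν u)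
    (h' : ScaleSquareIntegrable V W ν u') :
    Integrable (fun s => ⟪toScale W s (u s), toScale W s (u' s)⟫_ℝ) ν := by
  have h1 := (h.add hν hu hu' h').2
  refine (((h1.sub h.2).sub h'.2).const_mul (1 / 2)).congr ?_
  filter_upwards [h.1, h'.1] with s hs hs'
  simp only [Pi.add_apply, Pi.sub_apply]
  rw [toScale_add hs hs', real_inner_eq_norm_add_mul_self_sub_norm_mul_self_sub_norm_mul_self_div_two]
  ring

lemma scaleInner_comm {ν : Measure (Icc s₁ s₂)} (u u' : Icc s₁ s₂ → V) :
    scaleInner V W ν u u' = scaleInner V W ν u' u := by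
  simp only [scaleInner, real_inner_comm]

lemma scaleInner_self {ν : Measure (Icc s₁ s₂)} (u : Icc s₁ s₂ → V) :
    scaleInner V W ν u u = ∫ s, ‖toScale W s (u s)‖ ^ 2 ∂ν := by
  simp only [scaleInner, real_inner_self_eq_norm_sq]

lemma scaleInner_self_nonneg {ν : Measure (Icc s₁ s₂)} (u : Icc s₁ s₂ → V) :
    0 ≤ scaleInner V W ν u u := by
  rw [scaleInner_self]
  positivity

lemma scaleInner_add_left {ν : Measure (Icc s₁ s₂)} (hν : MeasurableNorms V W ν)
    {u u' w : Icc s₁ s₂ → V} (hu : StronglyMeasurable u) (hu' : StronglyMeasurable u')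
    (hw : StronglyMeasurable w) (h : ScaleSquareIntegrable V W ν u)
    (h' : ScaleSquareIntegrable V W ν u') (h'' : ScaleSquareIntegrable V W ν w) :
    scaleInner V W ν (u + u') w = scaleInner V W ν u w + scaleInner V W ν u' w := by
  rw [scaleInner, scaleInner, scaleInner,
    ← integral_add (h.integrable_inner hν hu hw h'') (h'.integrable_inner hν hu' hw h'')]
  apply integral_congr_ae
  filter_upwards [h.1, h'.1] with s hs hs'
  simp only [Pi.add_apply]
  rw [toScale_add hs hs', inner_add_left]

lemma scaleInner_smul_left {ν : Measure (Icc s₁ s₂)} {u w : Icc s₁ s₂ → V} (c : ℝ)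
    (h : ScaleSquareIntegrable V W ν u) :
    scaleInner V W ν (c • u) w = c * scaleInner V W ν u w := by
  rw [scaleInner, scaleInner, ← integral_const_mul]
  apply integral_congr_ae
  filter_upwards [h.1] with s hs
  simp only [Pi.smul_apply]
  rw [toScale_smul c hs, real_inner_smul_left]

lemma eq_zero_of_scaleInner_self {ν : Measure (Icc s₁ s₂)} {u : Icc s₁ s₂ → V}
    (h : ScaleSquareIntegrable V W ν u) (h0 : scaleInner V W ν u u = 0) : u =ᵐ[ν] 0 := by
  rw [scaleInner_self, integral_eq_zero_iff_of_nonneg (fun s => by positivity) h.2] at h0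
  filter_upwards [h.1, h0] with s h1 h2
  exact eq_zero_of_toScale h1 (by simpa using h2)

instance (s₁ s₂ : ℝ) : IsFiniteMeasure (lebesgue s₁ s₂) := by
  refine ⟨?_⟩
  rw [lebesgue, (MeasurableEmbedding.subtype_coe measurableSet_Icc).comap_apply]
  refine (measure_mono (t := Icc s₁ s₂) (by rintro _ ⟨x, -, rfl⟩; exact x.2)).trans_lt ?_
  simp

lemma integrable_smul_of_memLp {g : Icc s₁ s₂ → V} (hg : MemLp g 2 (lebesgue s₁ s₂)) {η : ℝ → ℝ}
    (hη : Continuous η) (hc : HasCompactSupport η) :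
    Integrable (fun s : Icc s₁ s₂ => η s • g s) (lebesgue s₁ s₂) := by
  obtain ⟨C, hC⟩ := hη.bounded_above_of_compact_support hc
  exact (hg.integrable (by norm_num)).bdd_smul C
    (hη.comp continuous_subtype_val).aestronglyMeasurable (Eventually.of_forall fun s => hC s)

lemma memLp_of_continuous {F : Type*} [NormedAddCommGroup F] (v : C(Icc s₁ s₂, F)) : MemLp v 2 (lebesgue s₁ s₂) :=
  v.continuous.memLp_of_hasCompactSupport (HasCompactSupport.of_compactSpace _)

variable (V W)

/-- The multiscale space `𝕎`, as a set of pairs `(v, ∂v)`. An element is a function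
`v ∈ H¹((s₁, s₂), V)`, given by its continuous version `v : [s₁, s₂] → V` together with its weak
derivative `∂v ∈ L²((s₁, s₂), V)` (which is determined by `v`), such that
`‖v‖_𝕎² = ∫ ‖v(s)‖_s² dρ(s) + ∫ ‖∂v(s)‖_s² ds < ∞`, where `v(s) ∈ W_s` for `ρ`-a.e. `s` and
`∂v(s) ∈ W_s` for Lebesgue-a.e. `s`. -/
def multiscaleSubmodule (ρ : Measure (Icc s₁ s₂)) [MultiscaleFamily V W ρ] :
    Submodule ℝ (C(Icc s₁ s₂, V) × Lp V 2 (lebesgue s₁ s₂)) where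
  carrier := {p | HasWeakDeriv p.1 p.2 ∧ ScaleSquareIntegrable V W ρ p.1 ∧
    ScaleSquareIntegrable V W (lebesgue s₁ s₂) p.2}
  add_mem' := by
    rintro ⟨v, g⟩ ⟨v', g'⟩ ⟨h1, h2, h3⟩ ⟨h1', h2', h3'⟩
    refine ⟨?_, ?_, ?_⟩
    · intro φ a b c
      have ha : Continuous φ := a.continuous
      have hda : Continuous (deriv φ) := a.continuous_deriv (by simp)
      have e1 : ∫ s, φ s • (g + g') s ∂(lebesgue s₁ s₂) =
          ∫ s, (φ s • g s + φ s • g' s) ∂(lebesgue s₁ s₂) := by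
        apply integral_congr_ae
        filter_upwards [Lp.coeFn_add g g'] with s hs
        rw [hs, Pi.add_apply, smul_add]
      have e2 : ∫ s, deriv φ s • (v + v') s ∂(lebesgue s₁ s₂) =
          ∫ s, (deriv φ s • v s + deriv φ s • v' s) ∂(lebesgue s₁ s₂) := by
        simp [smul_add]
      simp only [Prod.mk_add_mk]
      rw [e1, e2, integral_add (integrable_smul_of_memLp (Lp.memLp g) ha b)
        (integrable_smul_of_memLp (Lp.memLp g') ha b),
        integral_add (integrable_smul_of_memLp (memLp_of_continuous v) hda b.deriv)
        (integrable_smul_of_memLp (memLp_of_continuous v') hda b.deriv),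
        h1 φ a b c, h1' φ a b c]
      abel
    · exact h2.add (MultiscaleFamily.measurable_rho) v.continuous.stronglyMeasurable
        v'.continuous.stronglyMeasurable h2'
    · exact (h3.add (MultiscaleFamily.measurable_lebesgue ρ) (Lp.stronglyMeasurable g)
        (Lp.stronglyMeasurable g') h3').congr (Lp.coeFn_add g g').symm
  zero_mem' := by
    refine ⟨?_, ScaleSquareIntegrable.zero, ScaleSquareIntegrable.zero.congr
      (Lp.coeFn_zero V 2 (lebesgue s₁ s₂)).symm⟩
    intro φ a b c
    have e1 : ∫ s, φ s • (0 : Lp V 2 (lebesgue s₁ s₂)) s ∂(lebesgue s₁ s₂) = 0 := by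
      apply integral_eq_zero_of_ae
      filter_upwards [Lp.coeFn_zero V 2 (lebesgue s₁ s₂)] with s hs
      rw [hs]; simp
    simpa using e1
  smul_mem' := by
    rintro c ⟨v, g⟩ ⟨h1, h2, h3⟩
    refine ⟨?_, h2.smul c, (h3.smul c).congr (Lp.coeFn_smul c g).symm⟩
    intro φ a b e
    have e1 : ∫ s, φ s • (c • g) s ∂(lebesgue s₁ s₂) =
        ∫ s, c • (φ s • g s) ∂(lebesgue s₁ s₂) := by
      apply integral_congr_ae
      filter_upwards [Lp.coeFn_smul c g] with s hs
      rw [hs, Pi.smul_apply, smul_comm]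
    have e2 : ∫ s, deriv φ s • (c • v) s ∂(lebesgue s₁ s₂) =
        ∫ s, c • (deriv φ s • v s) ∂(lebesgue s₁ s₂) := by
      simp [smul_comm c]
    simp only [Prod.smul_mk]
    rw [e1, e2, integral_smul, integral_smul, h1 φ a b e, smul_neg]

/-- The multiscale space `𝕎` of scale-dependent vector fields, with its own Hilbert norm
`‖v‖_𝕎² = ∫ ‖v(s)‖_s² dρ(s) + ∫ ‖∂v(s)‖_s² ds`. -/
def MultiscaleSpace (ρ : Measure (Icc s₁ s₂)) [MultiscaleFamily V W ρ] :=
  ↥(multiscaleSubmodule V W ρ)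

namespace MultiscaleSpace

variable {V W} {ρ : Measure (Icc s₁ s₂)} [MultiscaleFamily V W ρ]

instance : AddCommGroup (MultiscaleSpace V W ρ) :=
  inferInstanceAs (AddCommGroup ↥(multiscaleSubmodule V W ρ))

instance : Module ℝ (MultiscaleSpace V W ρ) :=
  inferInstanceAs (Module ℝ ↥(multiscaleSubmodule V W ρ))

/-- The continuous version of `v`, as a map `[s₁, s₂] → V`; `v.toMap s` is the vector field
`v(s, ·)` at scale `s`. -/
def toMap (v : MultiscaleSpace V W ρ) : C(Icc s₁ s₂, V) := v.1.1

/-- The weak derivative of `v` with respect to the scale. -/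
def scaleDeriv (v : MultiscaleSpace V W ρ) : Lp V 2 (lebesgue s₁ s₂) := v.1.2

instance : Inner ℝ (MultiscaleSpace V W ρ) where
  inner v w := scaleInner V W ρ v.toMap w.toMap +
    scaleInner V W (lebesgue s₁ s₂) v.scaleDeriv w.scaleDeriv

lemma inner_def (v w : MultiscaleSpace V W ρ) :
    ⟪v, w⟫_ℝ = scaleInner V W ρ v.toMap w.toMap +
      scaleInner V W (lebesgue s₁ s₂) v.scaleDeriv w.scaleDeriv := rfl

variable [CompleteSpace V]

instance core : InnerProductSpace.Core ℝ (MultiscaleSpace V W ρ) where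
  conj_inner_symm v w := by
    simp only [inner_def, conj_trivial]
    rw [scaleInner_comm, scaleInner_comm (w.scaleDeriv : Icc s₁ s₂ → V)]
  re_inner_nonneg v := add_nonneg (scaleInner_self_nonneg _) (scaleInner_self_nonneg _)
  add_left u v w := by
    have h1 : scaleInner V W ρ (u + v).toMap w.toMap =
        scaleInner V W ρ u.toMap w.toMap + scaleInner V W ρ v.toMap w.toMap :=
      scaleInner_add_left MultiscaleFamily.measurable_rho u.toMap.continuous.stronglyMeasurable
        v.toMap.continuous.stronglyMeasurable w.toMap.continuous.stronglyMeasurable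
        u.2.2.1 v.2.2.1 w.2.2.1
    have h2 : scaleInner V W (lebesgue s₁ s₂) (u + v).scaleDeriv w.scaleDeriv =
        scaleInner V W (lebesgue s₁ s₂) u.scaleDeriv w.scaleDeriv +
        scaleInner V W (lebesgue s₁ s₂) v.scaleDeriv w.scaleDeriv :=
      (scaleInner_congr (Lp.coeFn_add u.scaleDeriv v.scaleDeriv) (ae_eq_refl _)).trans
      (scaleInner_add_left (MultiscaleFamily.measurable_lebesgue ρ)
        (Lp.stronglyMeasurable _) (Lp.stronglyMeasurable _) (Lp.stronglyMeasurable _)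
        u.2.2.2 v.2.2.2 w.2.2.2)
    rw [inner_def, inner_def, inner_def, h1, h2]
    ring
  smul_left v w c := by
    have h1 : scaleInner V W ρ (c • v).toMap w.toMap = c * scaleInner V W ρ v.toMap w.toMap :=
      scaleInner_smul_left c v.2.2.1
    have h2 : scaleInner V W (lebesgue s₁ s₂) (c • v).scaleDeriv w.scaleDeriv =
        c * scaleInner V W (lebesgue s₁ s₂) v.scaleDeriv w.scaleDeriv :=
      (scaleInner_congr (Lp.coeFn_smul c v.scaleDeriv) (ae_eq_refl _)).trans
      (scaleInner_smul_left c v.2.2.2)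
    rw [inner_def, inner_def, h1, h2, conj_trivial]
    ring
  definite v h := by
    rw [inner_def, add_eq_zero_iff_of_nonneg (scaleInner_self_nonneg _)
      (scaleInner_self_nonneg _)] at h
    have h1 := eq_zero_of_scaleInner_self v.2.2.1 h.1
    have h2 := eq_zero_of_scaleInner_self v.2.2.2 h.2
    have hρ : ρ ≠ 0 := MultiscaleFamily.ne_zero d V W
    have : (ae ρ).NeBot := ae_neBot.2 hρ
    obtain ⟨r, hr⟩ := h1.exists
    have hc := HasWeakDeriv.const v.2.1 h2
    apply Subtype.ext
    apply Prod.ext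
    · ext1 s
      exact (hc s r).trans hr
    · exact (Lp.eq_zero_iff_ae_eq_zero).2 h2

instance : NormedAddCommGroup (MultiscaleSpace V W ρ) :=
  InnerProductSpace.Core.toNormedAddCommGroup (𝕜 := ℝ)

instance : InnerProductSpace ℝ (MultiscaleSpace V W ρ) :=
  InnerProductSpace.ofCore core.toCore

lemma norm_sq_eq (v : MultiscaleSpace V W ρ) :
    ‖v‖ ^ 2 = (∫ s, ‖toScale W s (v.toMap s)‖ ^ 2 ∂ρ) +
      ∫ s, ‖toScale W s (v.scaleDeriv s)‖ ^ 2 ∂(lebesgue s₁ s₂) := by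
  rw [← scaleInner_self, ← scaleInner_self, ← inner_def, real_inner_self_eq_norm_sq]

end MultiscaleSpace

end MultiscaleSpace

section Flow

open scoped unitInterval

variable {d : ℕ} {s₁ s₂ : ℝ}
  (V : Type*) [NormedAddCommGroup V] [InnerProductSpace ℝ V] [CompleteSpace V]
  [RKHS ℝ V (Vec d) (Vec d)]
  (W : Icc s₁ s₂ → Type*) [∀ s, NormedAddCommGroup (W s)]
  [∀ s, InnerProductSpace ℝ (W s)] [∀ s, RKHS ℝ (W s) (Vec d) (Vec d)]
  (ρ : Measure (Icc s₁ s₂)) [MultiscaleFamily V W ρ]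

/-- `L²([0,1], 𝕎)`: the time-and-scale-dependent vector fields. -/
abbrev TimeScaleFields := Lp (MultiscaleSpace V W ρ) 2 (volume : Measure I)

variable {V W ρ}

/-- `φ` is a flow of `v`: `φ(t, s, x) = x + ∫₀ᵗ v(τ, s, φ(τ, s, x)) dτ` for all `t ∈ [0,1]`, all
scales `s ∈ [s₁, s₂]` and all `x ∈ ℝ^d`, where the integrand is integrable. -/
def IsFlow (v : TimeScaleFields V W ρ) (φ : I → Icc s₁ s₂ → Vec d → Vec d) : Prop :=
  ∀ (s : Icc s₁ s₂) (x : Vec d),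
    Integrable (fun τ : I => (v τ).toMap s (φ τ s x)) ∧
    ∀ t : I, φ t s x = x + ∫ τ in Iic t, (v τ).toMap s (φ τ s x)

/-- The flow `φ(·, ·, ·; v)` (a choice of a solution of the flow equation, if there is one). -/
def flow (v : TimeScaleFields V W ρ) : I → Icc s₁ s₂ → Vec d → Vec d :=
  Classical.epsilon (IsFlow v)

/-- The end map `φ(1, ·, ·; v)`, as an element of the space of maps
`[s₁, s₂] × ℝ^d → ℝ^d` with the topology of uniform convergence on compact sets. -/
def endMap (v : TimeScaleFields V W ρ) :
    (Icc s₁ s₂ × Vec d) →ᵤ[{K | IsCompact K}] Vec d :=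
  UniformOnFun.ofFun _ fun p => flow v 1 p.1 p.2

/-- The objective function of multiscale LDDMM,
`½ ∫₀¹ ‖v(t)‖_𝕎² dt + G(φ(1, ·, ·; v))`. -/
def objective (G : ((Icc s₁ s₂ × Vec d) →ᵤ[{K | IsCompact K}] Vec d) → ℝ)
    (v : TimeScaleFields V W ρ) : ℝ :=
  1 / 2 * (∫ t : I, ‖v t‖ ^ 2) + G (endMap v)

end Flow

end

/-! The heart of the matter is that `𝕎` embeds in `C([s₁, s₂], V)` with a Hölder modulus in the
scale. Each `w ∈ 𝕎` is, up to a constant, the primitive of `∂w`, so Cauchy–Schwarz bounds `‖w(s) -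
w(r)‖_V` by a multiple of `√|s - r| ‖w‖_𝕎`. As `ρ ≠ 0`, there is also a scale `r` at which
`‖w(r)‖_r` is controlled by `‖w‖_𝕎`. Together with `V ↪ C¹₀` this bounds the fields `w(s, ·)`, their
Lipschitz constants in `x` and their 1/2-Hölder constants in `s` by one multiple of `‖w‖_𝕎`
(`MultiscaleSpace.exists_field_bound`).

For `v ∈ L²([0,1], 𝕎)` the flow equation therefore has a right-hand side that is bounded and
Lipschitz in `x`, with constants square integrable in time. A contraction in an exponentially
weighted sup norm yields existence (`exists_integral_equation`); Grönwall yields uniqueness and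
stability (`IsFlow.norm_sub_le`).

For weak convergence, freeze the trajectories of the limit flow. The displacement `w ↦ ∫₀ᵗ w(τ, s,
φ(τ, s, x; v)) dτ` is linear and bounded, so the displacements of `u_n - v` tend to zero at each
`(t, s, x)`. They are equicontinuous in `(t, s, x)`, hence tend to zero uniformly on compact sets,
and they are exactly the error with which the flow of `v` solves the equation of `u_n`. Stability
concludes (`tendstoUniformlyOn_flow`).

Minimizers come from the direct method (`exists_minimizer_half_norm_sq_add`). `𝕎` is complete, so
bounded sequences in `L²([0,1], 𝕎)` have weak limits along ultrafilters; the norm is weakly lower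
semicontinuous, and so is `G` of the end map, because the end map is weakly continuous on bounded
sets (`tendsto_endMap`). -/

noncomputable section

/-! ### Primitives and Cauchy–Schwarz estimates -/

section Integrals

/-- The integral over `Iic s` depends continuously on `s` if the measure has no atoms. -/
lemma continuous_setIntegral_Iic {α E : Type*} [TopologicalSpace α] [LinearOrder α]
    [OrderTopology α] [FirstCountableTopology α] [MeasurableSpace α] [OpensMeasurableSpace α]
    {μ : Measure α} [NullSingletonClass μ] [NormedAddCommGroup E] [NormedSpace ℝ E] {f : α → E}
    (hf : Integrable f μ) : Continuous fun s => ∫ x in Iic s, f x ∂μ := by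
  have h : (fun s => ∫ x in Iic s, f x ∂μ) = fun s => ∫ x, (Iic s).indicator f x ∂μ :=
    funext fun s => (integral_indicator measurableSet_Iic).symm
  rw [h, continuous_iff_continuousAt]
  intro s
  refine continuousAt_of_dominated (bound := fun x => ‖f x‖)
    (Eventually.of_forall fun r => hf.1.indicator measurableSet_Iic)
    (Eventually.of_forall fun r => Eventually.of_forall fun x => norm_indicator_le_norm_self _ _)
    hf.norm ?_
  -- For `x ≠ s` the indicator of `Iic r` at `x` is constant for `r` near `s`; the exceptional point
  -- `s` is null.
  filter_upwards [(measure_eq_zero_iff_ae_notMem).1 (measure_singleton (μ := μ) s)] with x hx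
  rcases lt_or_gt_of_ne hx with hlt | hgt
  · refine (continuousAt_const (y := f x)).congr ?_
    filter_upwards [lt_mem_nhds hlt] with r hr
    simp [indicator, hr.le]
  · refine (continuousAt_const (y := (0 : E))).congr ?_
    filter_upwards [gt_mem_nhds hgt] with r hr
    simp [indicator, hr]

lemma setIntegral_Iic_sub {α E : Type*} [TopologicalSpace α] [LinearOrder α]
    [OrderClosedTopology α] [MeasurableSpace α] [OpensMeasurableSpace α]
    {μ : Measure α} [NormedAddCommGroup E] [NormedSpace ℝ E] {f : α → E}
    (hf : Integrable f μ) {r s : α} (hrs : r ≤ s) :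
    ∫ x in Iic s, f x ∂μ - ∫ x in Iic r, f x ∂μ = ∫ x in Ioc r s, f x ∂μ := by
  rw [← Iic_union_Ioc_eq_Iic hrs, setIntegral_union (Iic_disjoint_Ioc le_rfl) measurableSet_Ioc
    hf.integrableOn hf.integrableOn, add_sub_cancel_left]

/-- The Cauchy–Schwarz inequality for nonnegative functions. -/
lemma integral_mul_sq_le {α : Type*} [MeasurableSpace α] {μ : Measure α} {f g : α → ℝ}
    (hf : MemLp f 2 μ) (hg : MemLp g 2 μ) (hf0 : ∀ x, 0 ≤ f x) (hg0 : ∀ x, 0 ≤ g x) :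
    (∫ x, f x * g x ∂μ) ^ 2 ≤ (∫ x, f x ^ 2 ∂μ) * ∫ x, g x ^ 2 ∂μ := by
  have h := integral_mul_le_Lp_mul_Lq_of_nonneg (μ := μ) Real.HolderConjugate.two_two
    (Eventually.of_forall hf0) (Eventually.of_forall hg0) (by simpa using hf) (by simpa using hg)
  have h0 : 0 ≤ ∫ x, f x * g x ∂μ := integral_nonneg fun x => mul_nonneg (hf0 x) (hg0 x)
  simp only [Real.rpow_two, ← Real.sqrt_eq_rpow] at h
  rw [← Real.sqrt_mul (integral_nonneg fun x => by positivity)] at h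
  calc _ ≤ _ := pow_le_pow_left₀ h0 h 2
    _ = _ := Real.sq_sqrt (mul_nonneg (integral_nonneg fun x => by positivity)
      (integral_nonneg fun x => by positivity))

lemma Lp_norm_sq {α E : Type*} [MeasurableSpace α] {μ : Measure α} [NormedAddCommGroup E]
    (w : Lp E 2 μ) : ‖w‖ ^ 2 = ∫ x, ‖w x‖ ^ 2 ∂μ := by
  rw [Lp.norm_def, MemLp.eLpNorm_eq_integral_rpow_norm (by norm_num) (by norm_num) (Lp.memLp w),
    ENNReal.toReal_ofReal (by positivity)]
  simp only [ENNReal.toReal_ofNat, Real.rpow_ofNat]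
  rw [← one_div, ← Real.sqrt_eq_rpow, Real.sq_sqrt (integral_nonneg fun x => by positivity)]

/-- A vector-valued integral of a function dominated by an `L²` function. -/
lemma norm_setIntegral_le_of_norm_le_sq {α E : Type*} [MeasurableSpace α]
    {μ : Measure α} [IsFiniteMeasure μ] [NormedAddCommGroup E] [NormedSpace ℝ E]
    {a : α → ℝ} (ha : MemLp a 2 μ) (ha0 : ∀ x, 0 ≤ a x) {A : ℝ} (hA0 : 0 ≤ A)
    (hA : ∫ x, a x ^ 2 ∂μ ≤ A ^ 2) {f : α → E} (S : Set α)
    (hf : ∀ᵐ x ∂μ, ‖f x‖ ≤ a x) :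
    ‖∫ x in S, f x ∂μ‖ ≤ √(μ.real S) * A := by
  have h1 : ‖∫ x in S, f x ∂μ‖ ≤ ∫ x in S, 1 * a x ∂μ := by
    simp only [one_mul]
    exact norm_integral_le_of_norm_le ((ha.integrable (by norm_num)).integrableOn)
      (ae_restrict_of_ae hf)
  have h2 := integral_mul_sq_le (μ := μ.restrict S) (f := fun _ => 1) (memLp_const 1)
    (ha.restrict S) (fun _ => zero_le_one) ha0
  have h3 : ∫ x in S, a x ^ 2 ∂μ ≤ A ^ 2 :=
    (setIntegral_le_integral ha.integrable_sq (Eventually.of_forall fun x => by positivity)).trans hA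
  have h4 : (∫ x in S, 1 * a x ∂μ) ^ 2 ≤ μ.real S * A ^ 2 := by
    refine h2.trans ?_
    simp only [one_pow, integral_const, MeasurableSet.univ, measureReal_restrict_apply, univ_inter,
      smul_eq_mul, mul_one]
    gcongr
  refine h1.trans (Real.le_sqrt_of_sq_le h4 |>.trans_eq ?_)
  rw [Real.sqrt_mul measureReal_nonneg, Real.sqrt_sq hA0]

end Integrals

/-! ### Weak derivatives and the fundamental theorem of calculus -/

section WeakDerivative

variable {s₁ s₂ : ℝ} {V : Type*} [NormedAddCommGroup V] [InnerProductSpace ℝ V]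

instance (s₁ s₂ : ℝ) : NullSingletonClass (lebesgue s₁ s₂) := by
  refine ⟨fun x => ?_⟩
  rw [lebesgue, (MeasurableEmbedding.subtype_coe measurableSet_Icc).comap_apply]
  simp

lemma lebesgue_Ioc_real {r s : Icc s₁ s₂} (h : r ≤ s) :
    (lebesgue s₁ s₂).real (Ioc r s) = (s : ℝ) - r := by
  rw [measureReal_def, lebesgue,
    (MeasurableEmbedding.subtype_coe measurableSet_Icc).comap_apply]
  have : Subtype.val '' (Ioc r s) = Ioc (r : ℝ) s := by
    ext x
    constructor
    · rintro ⟨y, hy, rfl⟩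
      exact hy
    · intro hx
      exact ⟨⟨x, r.2.1.trans hx.1.le, hx.2.trans s.2.2⟩, hx, rfl⟩
  rw [this, Real.volume_Ioc, ENNReal.toReal_ofReal (sub_nonneg.2 h)]

lemma setIntegral_Ici_lebesgue (f : ℝ → V) (r : Icc s₁ s₂) :
    ∫ s in Ici r, f s ∂(lebesgue s₁ s₂) = ∫ x in (r : ℝ)..s₂, f x := by
  rw [intervalIntegral.integral_of_le r.2.2, ← integral_Icc_eq_integral_Ioc,
    ← integral_indicator measurableSet_Ici, ← integral_indicator measurableSet_Icc,
    ← integral_lebesgue (s₁ := s₁) (s₂ := s₂)]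
  · congr 1
    ext s
    by_cases h : r ≤ s
    · have : (s : ℝ) ∈ Icc (r : ℝ) s₂ := ⟨h, s.2.2⟩
      simp [indicator, h, this]
    · have : (s : ℝ) ∉ Icc (r : ℝ) s₂ := fun h' => h h'.1
      simp [indicator, h, this]
  · intro x hx
    rw [indicator_of_notMem]
    exact fun h => hx ⟨r.2.1.trans h.1, h.2⟩

lemma setIntegral_Iic_lebesgue (f : ℝ → V) (r : Icc s₁ s₂) :
    ∫ s in Iic r, f s ∂(lebesgue s₁ s₂) = ∫ x in s₁..(r : ℝ), f x := by
  rw [intervalIntegral.integral_of_le r.2.1, ← integral_Icc_eq_integral_Ioc,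
    ← integral_indicator measurableSet_Iic, ← integral_indicator measurableSet_Icc,
    ← integral_lebesgue (s₁ := s₁) (s₂ := s₂)]
  · congr 1
    ext s
    by_cases h : s ≤ r
    · have : (s : ℝ) ∈ Icc s₁ (r : ℝ) := ⟨s.2.1, h⟩
      simp [indicator, h, this]
    · have : (s : ℝ) ∉ Icc s₁ (r : ℝ) := fun h' => h h'.2
      simp [indicator, h, this]
  · intro x hx
    rw [indicator_of_notMem]
    exact fun h => hx ⟨h.1, h.2.trans r.2.2⟩

/-- The primitive of an integrable function has this function as weak derivative. -/
lemma hasWeakDeriv_primitive [CompleteSpace V] {g : Icc s₁ s₂ → V}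
    (hg : Integrable g (lebesgue s₁ s₂)) :
    HasWeakDeriv (fun s => ∫ x in Iic s, g x ∂(lebesgue s₁ s₂)) g := by
  intro φ hφ hc hs
  have hd : Continuous (deriv φ) := hφ.continuous_deriv (by simp)
  have hend : φ s₂ = 0 := image_eq_zero_of_notMem_tsupport fun h => (hs h).2.ne rfl
  set μ := lebesgue s₁ s₂
  -- Fubini on the triangle `x ≤ s`: integrating `φ'(s) g(x)` first in `x` gives `φ'` against the
  -- primitive; first in `s` it gives `-φ(x) g(x)`, since `φ` vanishes at `s₂`.
  let F : Icc s₁ s₂ → Icc s₁ s₂ → V := fun s x => (Iic s).indicator (fun x => deriv φ s • g x) x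
  have hdi : Integrable (fun s : Icc s₁ s₂ => deriv φ s) μ :=
    (hd.comp continuous_subtype_val).integrable_of_hasCompactSupport
      (HasCompactSupport.of_compactSpace _)
  have hF : Integrable (Function.uncurry F) (μ.prod μ) := by
    have h1 : Integrable (fun p : Icc s₁ s₂ × Icc s₁ s₂ => deriv φ p.1 • g p.2) (μ.prod μ) :=
      hdi.smul_prod hg
    have h2 : MeasurableSet {p : Icc s₁ s₂ × Icc s₁ s₂ | p.2 ≤ p.1} :=
      measurableSet_le measurable_snd measurable_fst
    refine (h1.indicator h2).congr (Eventually.of_forall fun p => ?_)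
    simp [F, Function.uncurry, indicator]
  have e1 : ∫ s, deriv φ s • (∫ x in Iic s, g x ∂μ) ∂μ = ∫ s, ∫ x, F s x ∂μ ∂μ := by
    congr 1
    ext s
    rw [← integral_smul, ← integral_indicator measurableSet_Iic]
  have e2 : ∫ x, ∫ s, F s x ∂μ ∂μ = ∫ x : Icc s₁ s₂, -(φ x • g x) ∂μ := by
    congr 1
    ext x
    have h3 : (fun s => F s x) = (Ici x).indicator fun s : Icc s₁ s₂ => deriv φ s • g x := by
      ext s
      simp [F, indicator]
    rw [h3, integral_indicator measurableSet_Ici, integral_smul_const,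
      setIntegral_Ici_lebesgue (deriv φ) x, intervalIntegral.integral_deriv_eq_sub
        (fun y _ => (hφ.differentiable (by simp)).differentiableAt) (hd.intervalIntegrable _ _),
      hend, zero_sub, neg_smul]
  rw [e1, integral_integral_swap hF, e2, integral_neg, neg_neg]

/-- The fundamental theorem of calculus for a continuous function with weak derivative in `L²`. -/
lemma HasWeakDeriv.sub_eq_setIntegral [CompleteSpace V] {v : C(Icc s₁ s₂, V)}
    {g : Lp V 2 (lebesgue s₁ s₂)} (h : HasWeakDeriv v g) {r s : Icc s₁ s₂} (hrs : r ≤ s) :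
    v s - v r = ∫ x in Ioc r s, g x ∂(lebesgue s₁ s₂) := by
  have hg : Integrable g (lebesgue s₁ s₂) := (Lp.memLp g).integrable (by norm_num)
  let P : C(Icc s₁ s₂, V) := ⟨fun s => ∫ x in Iic s, g x ∂(lebesgue s₁ s₂),
    continuous_setIntegral_Iic hg⟩
  have hP : HasWeakDeriv P g := hasWeakDeriv_primitive hg
  -- `v` and the primitive of `g` share their weak derivative, so their difference is constant.
  have h0 : HasWeakDeriv (v - P : C(Icc s₁ s₂, V)) 0 := by
    intro φ a b c
    have hda : Continuous (deriv φ) := a.continuous_deriv (by simp)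
    simp only [ContinuousMap.coe_sub, Pi.sub_apply, smul_sub]
    rw [integral_sub (integrable_smul_of_memLp (memLp_of_continuous v) hda b.deriv)
      (integrable_smul_of_memLp (memLp_of_continuous P) hda b.deriv)]
    have h1 := h φ a b c
    rw [hP φ a b c, neg_inj] at h1
    simp [h1]
  have h2 := HasWeakDeriv.const h0 (ae_eq_refl _) r s
  simp only [ContinuousMap.coe_sub, Pi.sub_apply] at h2
  rw [← setIntegral_Iic_sub hg hrs]
  change v s - v r = P s - P r
  rw [sub_eq_sub_iff_add_eq_add] at h2 ⊢
  rw [← h2, add_comm]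

end WeakDerivative

/-! ### Embedding of the multiscale space in continuous families of Lipschitz fields -/

section Bounds

variable {d : ℕ} {s₁ s₂ : ℝ}
  {V : Type*} [NormedAddCommGroup V] [InnerProductSpace ℝ V] [RKHS ℝ V (Vec d) (Vec d)]
  {W : Icc s₁ s₂ → Type*} [∀ s, NormedAddCommGroup (W s)]
  [∀ s, InnerProductSpace ℝ (W s)] [∀ s, RKHS ℝ (W s) (Vec d) (Vec d)]

/-- The mean value inequality on the convex set `ℝ^d` turns the bound on the differential into a
Lipschitz bound. Passing to `|C|` supplies the sign that the definition leaves open. -/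
lemma EmbedsInC10.exists_bound (h : EmbedsInC10 V) :
    ∃ C : ℝ, 0 ≤ C ∧ (∀ (u : V) (x : Vec d), ‖u x‖ ≤ C * ‖u‖) ∧
      ∀ (u : V) (x y : Vec d), ‖u x - u y‖ ≤ C * ‖u‖ * ‖x - y‖ := by
  obtain ⟨C, hC⟩ := h
  have hle : ∀ u : V, C * ‖u‖ ≤ |C| * ‖u‖ := fun u => by gcongr; exact le_abs_self C
  refine ⟨|C|, abs_nonneg C, fun u x => ((hC u).2.2.2 x).1.trans (hle u), fun u x y => ?_⟩
  refine Convex.norm_image_sub_le_of_norm_fderiv_le (𝕜 := ℝ) (s := univ)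
    (fun z _ => ((hC u).1.differentiable (by simp)) z)
    (fun z _ => ((hC u).2.2.2 z).2.trans (hle u)) convex_univ (mem_univ y) (mem_univ x)

/-- An element of `V` is determined by its values, so the preimage in `V` provided by the embedding
of `W_s` is `u` itself. -/
lemma NestedEmbeddings.exists_bound (h : NestedEmbeddings V W) :
    ∃ C : ℝ, 0 ≤ C ∧ ∀ (s : Icc s₁ s₂) (u : V), u ∈ scaleSubspace V W s →
      ‖u‖ ≤ C * ‖toScale W s u‖ := by
  obtain ⟨C, hC, -⟩ := h
  refine ⟨|C|, abs_nonneg C, fun s u hu => ?_⟩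
  obtain ⟨v, hv, hn⟩ := hC s (toScale W s u)
  have : v = u := DFunLike.coe_injective (hv.trans (coe_toScale hu))
  rw [this] at hn
  exact hn.trans (by gcongr; exact le_abs_self C)

/-- For a nonzero measure, a nonnegative integrable function takes somewhere (outside of a given
null set) a value controlled by its integral. -/
lemma exists_mul_le_integral {α : Type*} [MeasurableSpace α] {μ : Measure α} (hμ : μ ≠ 0) :
    ∃ c : ℝ, 0 < c ∧ ∀ (f : α → ℝ) (p : α → Prop), Integrable f μ → (∀ x, 0 ≤ f x) →
      (∀ᵐ x ∂μ, p x) → ∃ x, p x ∧ c * f x ≤ ∫ y, f y ∂μ := by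
  have : (ae μ).NeBot := ae_neBot.2 hμ
  -- The measure may have infinite mass; truncating the mass at `1` keeps the constant finite.
  have hpos : 0 < min (μ univ) 1 := lt_min (Measure.measure_univ_pos.2 hμ) one_pos
  have hfin : min (μ univ) 1 ≠ ⊤ := ne_top_of_le_ne_top ENNReal.one_ne_top (min_le_right _ _)
  set m := (min (μ univ) 1).toReal
  have hm : 0 < m := ENNReal.toReal_pos hpos.ne' hfin
  -- Half of the truncated mass leaves room for a contradiction: if `∫ f < (m / 2) f` held almost
  -- everywhere with `∫ f > 0`, integration would give total mass at most `m / 2`.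
  refine ⟨m / 2, half_pos hm, fun f p hf hf0 hp => ?_⟩
  rcases (integral_nonneg hf0 : 0 ≤ ∫ y, f y ∂μ).eq_or_lt with h0 | h0
  · have h1 := (integral_eq_zero_iff_of_nonneg hf0 hf).1 h0.symm
    obtain ⟨x, hx, hx'⟩ := (hp.and h1).exists
    refine ⟨x, hx, ?_⟩
    rw [hx', ← h0]
    simp
  by_contra! hcon
  have h1 : ENNReal.ofReal (∫ y, f y ∂μ) * μ univ ≤
      ENNReal.ofReal (∫ y, m / 2 * f y ∂μ) := by
    rw [ofReal_integral_eq_lintegral_ofReal (hf.const_mul _)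
      (Eventually.of_forall fun x => mul_nonneg (half_pos hm).le (hf0 x)), ← lintegral_const]
    refine lintegral_mono_ae ?_
    filter_upwards [hp] with x hx
    exact ENNReal.ofReal_le_ofReal (hcon x hx).le
  rw [integral_const_mul, mul_comm (m / 2), ENNReal.ofReal_mul h0.le] at h1
  have h2 := (ENNReal.mul_le_mul_iff_right (ENNReal.ofReal_pos.2 h0).ne' ENNReal.ofReal_ne_top).1 h1
  have h3 : ENNReal.ofReal (m / 2) < min (μ univ) 1 := by
    rw [← ENNReal.ofReal_toReal hfin]
    exact (ENNReal.ofReal_lt_ofReal_iff hm).2 (half_lt_self hm)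
  exact absurd (h3.trans_le (min_le_left _ _)) (not_lt.2 h2)

lemma ScaleSquareIntegrable.memLp_norm {ν : Measure (Icc s₁ s₂)} (hν : MeasurableNorms V W ν)
    {u : Icc s₁ s₂ → V} (hu : StronglyMeasurable u) (h : ScaleSquareIntegrable V W ν u) :
    MemLp (fun s => ‖toScale W s (u s)‖) 2 ν :=
  (memLp_two_iff_integrable_sq (hν u hu h.1)).2 h.2

namespace MultiscaleSpace

variable {ρ : Measure (Icc s₁ s₂)} [MultiscaleFamily V W ρ]

lemma hasWeakDeriv (w : MultiscaleSpace V W ρ) : HasWeakDeriv w.toMap w.scaleDeriv := w.2.1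

lemma squareIntegrable_toMap (w : MultiscaleSpace V W ρ) :
    ScaleSquareIntegrable V W ρ w.toMap := w.2.2.1

lemma squareIntegrable_scaleDeriv (w : MultiscaleSpace V W ρ) :
    ScaleSquareIntegrable V W (lebesgue s₁ s₂) w.scaleDeriv := w.2.2.2

variable [CompleteSpace V]

lemma integral_toMap_le (w : MultiscaleSpace V W ρ) :
    ∫ s, ‖toScale W s (w.toMap s)‖ ^ 2 ∂ρ ≤ ‖w‖ ^ 2 := by
  rw [norm_sq_eq]
  exact le_add_of_nonneg_right (integral_nonneg fun s => by positivity)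

lemma integral_scaleDeriv_le (w : MultiscaleSpace V W ρ) :
    ∫ s, ‖toScale W s (w.scaleDeriv s)‖ ^ 2 ∂(lebesgue s₁ s₂) ≤ ‖w‖ ^ 2 := by
  rw [norm_sq_eq]
  exact le_add_of_nonneg_left (integral_nonneg fun s => by positivity)

variable (V W ρ)

/-- The elements of the multiscale space are `1/2`-Hölder continuous in the scale. -/
lemma exists_holder_bound : ∃ C : ℝ, 0 ≤ C ∧ ∀ (w : MultiscaleSpace V W ρ) (r s : Icc s₁ s₂),
    ‖w.toMap s - w.toMap r‖ ≤ C * √|(s : ℝ) - r| * ‖w‖ := by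
  obtain ⟨C, hC0, hC⟩ := (‹MultiscaleFamily V W ρ›.nested).exists_bound
  have key : ∀ (w : MultiscaleSpace V W ρ) (r s : Icc s₁ s₂), r ≤ s →
      ‖w.toMap s - w.toMap r‖ ≤ C * √|(s : ℝ) - r| * ‖w‖ := by
    intro w r s hrs
    rw [w.hasWeakDeriv.sub_eq_setIntegral hrs]
    have hm := w.squareIntegrable_scaleDeriv.memLp_norm (MultiscaleFamily.measurable_lebesgue ρ)
      (Lp.stronglyMeasurable _)
    -- Cauchy–Schwarz over `Ioc r s`: the factor `√(s - r)` is the root of the measure of the set.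
    have h := norm_setIntegral_le_of_norm_le_sq (hm.const_mul C)
      (fun s => by positivity) (A := C * ‖w‖) (by positivity) ?_ (Ioc r s)
      (f := w.scaleDeriv) ?_
    · rw [lebesgue_Ioc_real hrs] at h
      rw [abs_of_nonneg (sub_nonneg.2 (Subtype.coe_le_coe.2 hrs))]
      exact h.trans_eq (by ring)
    · simp only [mul_pow]
      rw [integral_const_mul]
      exact mul_le_mul_of_nonneg_left w.integral_scaleDeriv_le (sq_nonneg C)
    · filter_upwards [w.squareIntegrable_scaleDeriv.1] with s hs using hC s _ hs
  refine ⟨C, hC0, fun w r s => ?_⟩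
  rcases le_total r s with h | h
  · exact key w r s h
  · rw [norm_sub_rev, abs_sub_comm]
    exact key w s r h

/-- The multiscale space is continuously embedded in `C([s₁, s₂], V)`. -/
lemma exists_sup_bound : ∃ C : ℝ, 0 ≤ C ∧ ∀ (w : MultiscaleSpace V W ρ) (s : Icc s₁ s₂),
    ‖w.toMap s‖ ≤ C * ‖w‖ := by
  obtain ⟨C, hC0, hC⟩ := (‹MultiscaleFamily V W ρ›.nested).exists_bound
  obtain ⟨C', hC0', hC'⟩ := exists_holder_bound V W ρ
  obtain ⟨c, hc, hc'⟩ := exists_mul_le_integral (MultiscaleFamily.ne_zero d V W : ρ ≠ 0)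
  -- The first term bounds `w` at a well-chosen scale `r`; the second is the Hölder cost of moving
  -- from `r` to any other scale.
  refine ⟨C * √c⁻¹ + C' * √(s₂ - s₁), by positivity, fun w s => ?_⟩
  obtain ⟨r, hr, hr'⟩ := hc' _ _ w.squareIntegrable_toMap.2 (fun s => by positivity) w.squareIntegrable_toMap.1
  have h1 : ‖toScale W r (w.toMap r)‖ ≤ √c⁻¹ * ‖w‖ := by
    rw [← Real.sqrt_sq (norm_nonneg w), ← Real.sqrt_mul (by positivity)]
    apply Real.le_sqrt_of_sq_le
    rw [inv_mul_eq_div, le_div_iff₀' hc]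
    exact hr'.trans w.integral_toMap_le
  have h2 : √|(s : ℝ) - r| ≤ √(s₂ - s₁) := by
    apply Real.sqrt_le_sqrt
    rw [abs_le]
    constructor <;> linarith [s.2.1, s.2.2, r.2.1, r.2.2]
  calc ‖w.toMap s‖ = ‖w.toMap r + (w.toMap s - w.toMap r)‖ := by rw [add_sub_cancel]
    _ ≤ ‖w.toMap r‖ + ‖w.toMap s - w.toMap r‖ := norm_add_le _ _
    _ ≤ C * (√c⁻¹ * ‖w‖) + C' * √(s₂ - s₁) * ‖w‖ := by
      refine add_le_add ((hC r _ hr).trans (by gcongr)) ((hC' w r s).trans (by gcongr))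
    _ = _ := by ring

/-- Bounds for the vector fields `w(s, ·)`, `w ∈ 𝕎`, which are uniform in the scale. -/
lemma exists_field_bound : ∃ C : ℝ, 0 ≤ C ∧
    (∀ (w : MultiscaleSpace V W ρ) (s : Icc s₁ s₂) (x : Vec d), ‖w.toMap s x‖ ≤ C * ‖w‖) ∧
    (∀ (w : MultiscaleSpace V W ρ) (s : Icc s₁ s₂) (x y : Vec d),
      ‖w.toMap s x - w.toMap s y‖ ≤ C * ‖w‖ * ‖x - y‖) ∧
    ∀ (w : MultiscaleSpace V W ρ) (r s : Icc s₁ s₂) (x : Vec d),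
      ‖w.toMap s x - w.toMap r x‖ ≤ C * ‖w‖ * √|(s : ℝ) - r| := by
  obtain ⟨A, hA0, hA, hA'⟩ := (‹MultiscaleFamily V W ρ›.embeds).exists_bound
  obtain ⟨B, hB0, hB⟩ := exists_sup_bound V W ρ
  obtain ⟨C, hC0, hC⟩ := exists_holder_bound V W ρ
  refine ⟨A * (B + C), by positivity, fun w s x => ?_, fun w s x y => ?_, fun w r s x => ?_⟩
  · calc _ ≤ A * (B * ‖w‖) := (hA _ x).trans (by gcongr; exact hB w s)
      _ ≤ A * ((B + C) * ‖w‖) := by gcongr; linarith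
      _ = _ := by ring
  · calc _ ≤ A * (B * ‖w‖) * ‖x - y‖ := (hA' _ x y).trans (by gcongr; exact hB w s)
      _ ≤ A * ((B + C) * ‖w‖) * ‖x - y‖ := by gcongr; linarith
      _ = _ := by ring
  · have h := hA (w.toMap s - w.toMap r) x
    rw [RKHS.coe_sub] at h
    calc _ ≤ A * (C * √|(s : ℝ) - r| * ‖w‖) := h.trans (by gcongr; exact hC w r s)
      _ ≤ A * ((B + C) * √|(s : ℝ) - r| * ‖w‖) := by gcongr; linarith
      _ = _ := by ring

end MultiscaleSpace

end Bounds

/-! ### Stability of weak derivatives under limits -/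

section WeakDerivativeLimit

variable {s₁ s₂ : ℝ} {V : Type*} [NormedAddCommGroup V] [InnerProductSpace ℝ V]

/-- By Cauchy–Schwarz, pairing with a bounded test function is Lipschitz on `L²`; this lets the
defining identity of weak derivatives pass to limits. -/
lemma continuous_integral_smul_Lp {ψ : ℝ → ℝ} (hψ : Continuous ψ) (hc : HasCompactSupport ψ) :
    Continuous fun g : Lp V 2 (lebesgue s₁ s₂) => ∫ s, ψ s • g s ∂(lebesgue s₁ s₂) := by
  obtain ⟨M, hM⟩ := hψ.bounded_above_of_compact_support hc
  have hM0 : 0 ≤ M := (norm_nonneg _).trans (hM 0)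
  refine (LipschitzWith.of_dist_le_mul (K := ⟨√((lebesgue s₁ s₂).real univ) * M, by positivity⟩)
    fun g g' => ?_).continuous
  have h1 : ∫ s, ψ s • g s ∂(lebesgue s₁ s₂) - ∫ s, ψ s • g' s ∂(lebesgue s₁ s₂) =
      ∫ s in univ, ψ s • (g - g') s ∂(lebesgue s₁ s₂) := by
    rw [← integral_sub (integrable_smul_of_memLp (Lp.memLp g) hψ hc)
      (integrable_smul_of_memLp (Lp.memLp g') hψ hc), setIntegral_univ]
    apply integral_congr_ae
    filter_upwards [Lp.coeFn_sub g g'] with s hs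
    rw [hs, Pi.sub_apply, smul_sub]
  rw [dist_eq_norm, dist_eq_norm, h1]
  refine (norm_setIntegral_le_of_norm_le_sq (A := M * ‖g - g'‖)
    ((Lp.memLp (g - g')).norm.const_mul M) (fun s => by positivity) (by positivity) ?_ univ
    (Eventually.of_forall fun s => ?_)).trans_eq ?_
  · simp only [mul_pow]
    rw [integral_const_mul, Lp_norm_sq]
  · rw [norm_smul]
    gcongr
    exact hM _
  · exact (mul_assoc _ _ _).symm

/-- Weak derivatives are preserved by limits. -/
lemma HasWeakDeriv.of_tendsto {ι : Type*} {l : Filter ι} [l.NeBot] {v : ι → C(Icc s₁ s₂, V)}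
    {v' : C(Icc s₁ s₂, V)} {g : ι → Lp V 2 (lebesgue s₁ s₂)} {g' : Lp V 2 (lebesgue s₁ s₂)}
    (h : ∀ i, HasWeakDeriv (v i) (g i)) (hv : Tendsto v l (𝓝 v')) (hg : Tendsto g l (𝓝 g')) :
    HasWeakDeriv v' g' := by
  intro φ a b c
  have hda : Continuous (deriv φ) := a.continuous_deriv (by simp)
  -- Regarding the continuous function as an element of `L²` makes the same continuity statement
  -- serve both sides of the identity.
  have e : ∀ w : C(Icc s₁ s₂, V), ∫ s, deriv φ s • w s ∂(lebesgue s₁ s₂) =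
      ∫ s, deriv φ s • ContinuousMap.toLp (E := V) 2 (lebesgue s₁ s₂) ℝ w s
        ∂(lebesgue s₁ s₂) := by
    intro w
    apply integral_congr_ae
    filter_upwards [ContinuousMap.coeFn_toLp (E := V) (p := 2) (𝕜 := ℝ) (lebesgue s₁ s₂) w]
      with s hs
    rw [hs]
  have h1 := ((continuous_integral_smul_Lp a.continuous b).tendsto g').comp hg
  have h2 := ((continuous_integral_smul_Lp (V := V) (s₁ := s₁) (s₂ := s₂) hda b.deriv).tendsto
    (ContinuousMap.toLp (E := V) 2 (lebesgue s₁ s₂) ℝ v')).comp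
    (((ContinuousMap.toLp (E := V) 2 (lebesgue s₁ s₂) ℝ).continuous.tendsto v').comp hv)
  rw [e]
  refine tendsto_nhds_unique h1 (h2.neg.congr fun i => ?_)
  simp only [Function.comp_apply]
  rw [h i φ a b c, e]

end WeakDerivativeLimit

/-! ### Completeness of the multiscale space -/

section Completeness

variable {d : ℕ} {s₁ s₂ : ℝ}
  {V : Type*} [NormedAddCommGroup V] [InnerProductSpace ℝ V] [RKHS ℝ V (Vec d) (Vec d)]
  {W : Icc s₁ s₂ → Type*} [∀ s, NormedAddCommGroup (W s)]
  [∀ s, InnerProductSpace ℝ (W s)] [∀ s, RKHS ℝ (W s) (Vec d) (Vec d)]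

lemma toScale_sub {s : Icc s₁ s₂} {u u' : V} (h : u ∈ scaleSubspace V W s)
    (h' : u' ∈ scaleSubspace V W s) :
    toScale W s (u - u') = toScale W s u - toScale W s u' :=
  toScale_eq (by simp [coe_toScale h, coe_toScale h'])

lemma ScaleSquareIntegrable.sub {ν : Measure (Icc s₁ s₂)} (hν : MeasurableNorms V W ν)
    {u u' : Icc s₁ s₂ → V} (hu : StronglyMeasurable u) (hu' : StronglyMeasurable u')
    (h : ScaleSquareIntegrable V W ν u) (h' : ScaleSquareIntegrable V W ν u') :
    ScaleSquareIntegrable V W ν (u - u') := by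
  have := h.add hν hu (hu'.const_smul (-1 : ℝ)) (h'.smul (-1))
  simpa [sub_eq_add_neg] using this

/-- If `w_n → u` in `V` along a subsequence and `w_n` is a Cauchy sequence of `W_s`, then `u`
belongs to `W_s` and `w_n → u` in `W_s`. -/
lemma tendsto_toScale_of_cauchySeq [∀ s, CompleteSpace (W s)] {s : Icc s₁ s₂} {u : ℕ → V} {u' : V}
    (hu : ∀ n, u n ∈ scaleSubspace V W s) (hc : CauchySeq fun n => toScale W s (u n))
    {ns : ℕ → ℕ} (hns : Tendsto ns atTop atTop) (hlim : Tendsto (u ∘ ns) atTop (𝓝 u')) :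
    u' ∈ scaleSubspace V W s ∧
      Tendsto (fun n => toScale W s (u n)) atTop (𝓝 (toScale W s u')) := by
  obtain ⟨w, hw⟩ := cauchySeq_tendsto_of_complete hc
  -- Convergence in either space implies pointwise convergence of the fields, so both limits are the
  -- same function.
  have hwu : (w : Vec d → Vec d) = u' := by
    have h1 : Tendsto (fun k => (u (ns k) : Vec d → Vec d)) atTop (𝓝 u') :=
      ((RKHS.coeCLM ℝ (H := V) (X := Vec d) (V := Vec d)).continuous.tendsto u').comp hlim
    have h2 : Tendsto (fun k => (toScale W s (u (ns k)) : Vec d → Vec d)) atTop (𝓝 w) :=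
      ((RKHS.coeCLM ℝ (H := W s) (X := Vec d) (V := Vec d)).continuous.tendsto w).comp
        (hw.comp hns)
    exact tendsto_nhds_unique h2 (h1.congr fun k => (coe_toScale (hu _)).symm)
  refine ⟨⟨w, hwu⟩, ?_⟩
  rwa [toScale_eq hwu]

/-- A sequence of sections whose successive `L²` distances are at most `2⁻ⁿ` is almost everywhere
a Cauchy sequence. -/
lemma ae_cauchySeq_toScale {ν : Measure (Icc s₁ s₂)} (hν : MeasurableNorms V W ν)
    {u : ℕ → Icc s₁ s₂ → V} (hu : ∀ n, StronglyMeasurable (u n))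
    (hsq : ∀ n, ScaleSquareIntegrable V W ν (u n))
    (hdiff : ∀ n, ∫ s, ‖toScale W s (u n s - u (n + 1) s)‖ ^ 2 ∂ν ≤ (1 / 4) ^ n) :
    ∀ᵐ s ∂ν, CauchySeq fun n => toScale W s (u n s) := by
  have hd : ∀ n, ScaleSquareIntegrable V W ν (u n - u (n + 1)) := fun n =>
    (hsq n).sub hν (hu n) (hu (n + 1)) (hsq (n + 1))
  -- The weight `2ⁿ` is affordable, since the squared distances integrate to at most `4⁻ⁿ`, and
  -- strong enough: finiteness of `∑ 2ⁿ Dₙ²` forces that of `∑ Dₙ`.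
  set D : ℕ → Icc s₁ s₂ → ℝ := fun n s => ‖toScale W s (u n s - u (n + 1) s)‖ with hD
  have hDi : ∀ n, Integrable (fun s => 2 ^ n * D n s ^ 2) ν := fun n => (hd n).2.const_mul _
  have hDm : ∀ n, AEMeasurable (fun s => ENNReal.ofReal (2 ^ n * D n s ^ 2)) ν := fun n =>
    (hDi n).1.aemeasurable.ennreal_ofReal
  have hle : ∀ n, ∫⁻ s, ENNReal.ofReal (2 ^ n * D n s ^ 2) ∂ν ≤ ENNReal.ofReal ((1 / 2) ^ n) := by
    intro n
    rw [← ofReal_integral_eq_lintegral_ofReal (hDi n)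
      (Eventually.of_forall fun s => by positivity), integral_const_mul]
    apply ENNReal.ofReal_le_ofReal
    calc _ ≤ 2 ^ n * (1 / 4 : ℝ) ^ n := by gcongr; exact hdiff n
      _ = (1 / 2) ^ n := by rw [← mul_pow]; norm_num
  have hfin : ∫⁻ s, ∑' n, ENNReal.ofReal (2 ^ n * D n s ^ 2) ∂ν ≠ ⊤ := by
    rw [lintegral_tsum hDm]
    exact ne_top_of_le_ne_top
      (summable_geometric_of_lt_one (by norm_num) (by norm_num) :
        Summable fun n : ℕ => (1 / 2 : ℝ) ^ n).tsum_ofReal_ne_top (ENNReal.tsum_le_tsum hle)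
  filter_upwards [ae_lt_top' (AEMeasurable.tsum hDm) hfin,
    ae_all_iff.2 fun n => (hsq n).1] with s hs hmem
  have hsum : Summable fun n => 2 ^ n * D n s ^ 2 := by
    refine (ENNReal.summable_toReal hs.ne).congr fun n => ?_
    rw [ENNReal.toReal_ofReal (by positivity)]
  refine cauchySeq_of_summable_dist (Summable.of_nonneg_of_le (fun n => dist_nonneg) (fun n => ?_)
    (hsum.add (summable_geometric_of_lt_one (by norm_num) (by norm_num) :
        Summable fun n : ℕ => (1 / 2 : ℝ) ^ n)))
  rw [dist_eq_norm, ← toScale_sub (hmem n) (hmem _)]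
  change D n s ≤ _
  have h1 : (2 : ℝ) ^ n * (1 / 2) ^ n = 1 := by rw [← mul_pow]; norm_num
  have h2 : 0 < (2 : ℝ) ^ n := by positivity
  have h3 : 0 ≤ (1 / 2 : ℝ) ^ n := by positivity
  have h4 : 0 ≤ D n s := norm_nonneg _
  -- Expanding the square gives `2 Dₙ ≤ 2ⁿ Dₙ² + 2⁻ⁿ`.
  have h5 : 0 ≤ (2 : ℝ) ^ n * (D n s - (1 / 2) ^ n) ^ 2 := by positivity
  have h6 : (2 : ℝ) ^ n * (D n s - (1 / 2) ^ n) ^ 2 =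
      2 ^ n * D n s ^ 2 - 2 * (2 ^ n * (1 / 2) ^ n) * D n s + (2 ^ n * (1 / 2) ^ n) * (1 / 2) ^ n := by
    ring
  rw [h6, h1] at h5
  linarith

/-- Completeness of the space of square integrable sections, for rapidly converging sequences. -/
lemma ScaleSquareIntegrable.of_tendsto [∀ s, CompleteSpace (W s)] {ν : Measure (Icc s₁ s₂)}
    (hν : MeasurableNorms V W ν) {u : ℕ → Icc s₁ s₂ → V} {u' : Icc s₁ s₂ → V}
    (hu : ∀ n, StronglyMeasurable (u n)) (hu' : StronglyMeasurable u')
    (hsq : ∀ n, ScaleSquareIntegrable V W ν (u n))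
    (hdiff : ∀ n m, n ≤ m → ∫ s, ‖toScale W s (u n s - u m s)‖ ^ 2 ∂ν ≤ (1 / 4) ^ n)
    {ns : ℕ → ℕ} (hns : Tendsto ns atTop atTop)
    (hlim : ∀ᵐ s ∂ν, Tendsto (fun k => u (ns k) s) atTop (𝓝 (u' s))) :
    ScaleSquareIntegrable V W ν u' ∧
      ∀ n, ∫ s, ‖toScale W s (u n s - u' s)‖ ^ 2 ∂ν ≤ (1 / 4) ^ n := by
  have hconv : ∀ᵐ s ∂ν, (∀ n, u n s ∈ scaleSubspace V W s) ∧ u' s ∈ scaleSubspace V W s ∧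
      Tendsto (fun n => toScale W s (u n s)) atTop (𝓝 (toScale W s (u' s))) := by
    filter_upwards [ae_cauchySeq_toScale hν hu hsq fun n => hdiff n (n + 1) n.le_succ,
      ae_all_iff.2 fun n => (hsq n).1, hlim] with s h1 h2 h3
    exact ⟨h2, tendsto_toScale_of_cauchySeq h2 h1 hns h3⟩
  have hmeas : ∀ n, AEStronglyMeasurable (fun s => ‖toScale W s (u n s - u' s)‖ ^ 2) ν :=
    fun n => (hν (u n - u') ((hu n).sub hu') (hconv.mono fun s hs =>
      Submodule.sub_mem _ (hs.1 n) hs.2.1)).pow 2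
  have hbound : ∀ n, ∫⁻ s, ENNReal.ofReal (‖toScale W s (u n s - u' s)‖ ^ 2) ∂ν ≤
      ENNReal.ofReal ((1 / 4) ^ n) := by
    intro n
    have hd : ∀ m, Integrable (fun s => ‖toScale W s (u n s - u m s)‖ ^ 2) ν := fun m =>
      ((hsq n).sub hν (hu n) (hu m) (hsq m)).2
    -- Fatou's lemma as `m → ∞` in the bound for `u n - u m`.
    calc ∫⁻ s, ENNReal.ofReal (‖toScale W s (u n s - u' s)‖ ^ 2) ∂ν
        = ∫⁻ s, liminf (fun m => ENNReal.ofReal (‖toScale W s (u n s - u m s)‖ ^ 2)) atTop ∂ν := by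
          apply lintegral_congr_ae
          filter_upwards [hconv] with s hs
          refine (Tendsto.liminf_eq ?_).symm
          refine (ENNReal.continuous_ofReal.tendsto _).comp (Tendsto.pow (Tendsto.norm ?_) 2)
          rw [toScale_sub (hs.1 n) hs.2.1]
          refine (tendsto_const_nhds.sub hs.2.2).congr fun m => ?_
          rw [toScale_sub (hs.1 n) (hs.1 m)]
      _ ≤ liminf (fun m => ∫⁻ s, ENNReal.ofReal (‖toScale W s (u n s - u m s)‖ ^ 2) ∂ν) atTop :=
          lintegral_liminf_le' fun m => (hd m).1.aemeasurable.ennreal_ofReal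
      _ ≤ ENNReal.ofReal ((1 / 4) ^ n) := by
          refine liminf_le_of_frequently_le' (Eventually.frequently ?_)
          filter_upwards [eventually_ge_atTop n] with m hm
          rw [← ofReal_integral_eq_lintegral_ofReal (hd m)
            (Eventually.of_forall fun s => by positivity)]
          exact ENNReal.ofReal_le_ofReal (hdiff n m hm)
  have hint : ∀ n, ScaleSquareIntegrable V W ν (u n - u') := fun n => by
    refine ⟨hconv.mono fun s hs => Submodule.sub_mem _ (hs.1 n) hs.2.1, hmeas n, ?_⟩
    rw [hasFiniteIntegral_iff_ofReal (Eventually.of_forall fun s => by positivity)]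
    exact (hbound n).trans_lt ENNReal.ofReal_lt_top
  refine ⟨?_, fun n => ?_⟩
  -- The limit is `u 0 - (u 0 - u')`, a difference of square integrable sections.
  · simpa using (hsq 0).sub hν (hu 0) ((hu 0).sub hu') (hint 0)
  · rw [← ENNReal.ofReal_le_ofReal_iff (by positivity)]
    exact (ofReal_integral_eq_lintegral_ofReal (hint n).2
      (Eventually.of_forall fun s => by positivity)).trans_le (hbound n)

namespace MultiscaleSpace

variable {ρ : Measure (Icc s₁ s₂)} [MultiscaleFamily V W ρ]

lemma scaleDeriv_sub (v w : MultiscaleSpace V W ρ) :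
    (v - w).scaleDeriv = v.scaleDeriv - w.scaleDeriv := rfl

lemma toMap_sub (v w : MultiscaleSpace V W ρ) : (v - w).toMap = v.toMap - w.toMap := rfl

lemma integral_scaleDeriv_sub (v w : MultiscaleSpace V W ρ) :
    ∫ s, ‖toScale W s ((v - w).scaleDeriv s)‖ ^ 2 ∂(lebesgue s₁ s₂) =
      ∫ s, ‖toScale W s (v.scaleDeriv s - w.scaleDeriv s)‖ ^ 2 ∂(lebesgue s₁ s₂) := by
  apply integral_congr_ae
  filter_upwards [Lp.coeFn_sub v.scaleDeriv w.scaleDeriv] with s hs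
  rw [scaleDeriv_sub, hs, Pi.sub_apply]

lemma sub_apply (v w : MultiscaleSpace V W ρ) (s : Icc s₁ s₂) (x : Vec d) :
    (v - w).toMap s x = v.toMap s x - w.toMap s x := by
  rw [toMap_sub, ContinuousMap.sub_apply, RKHS.coe_sub, Pi.sub_apply]

variable [CompleteSpace V]

lemma integral_toMap_sub_le (v w : MultiscaleSpace V W ρ) :
    ∫ s, ‖toScale W s (v.toMap s - w.toMap s)‖ ^ 2 ∂ρ ≤ ‖v - w‖ ^ 2 :=
  (v - w).integral_toMap_le

variable (V W ρ) in
lemma exists_norm_scaleDeriv_le : ∃ C : ℝ, 0 ≤ C ∧ ∀ w : MultiscaleSpace V W ρ,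
    ‖w.scaleDeriv‖ ≤ C * ‖w‖ := by
  obtain ⟨C, hC0, hC⟩ := (‹MultiscaleFamily V W ρ›.nested).exists_bound
  refine ⟨C, hC0, fun w => ?_⟩
  rw [← sq_le_sq₀ (norm_nonneg _) (by positivity), Lp_norm_sq, mul_pow]
  calc _ ≤ ∫ s, C ^ 2 * ‖toScale W s (w.scaleDeriv s)‖ ^ 2 ∂(lebesgue s₁ s₂) := by
        refine integral_mono_ae (Lp.memLp _).norm.integrable_sq
          (w.squareIntegrable_scaleDeriv.2.const_mul _) ?_
        filter_upwards [w.squareIntegrable_scaleDeriv.1] with s hs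
        rw [← mul_pow]
        exact pow_le_pow_left₀ (norm_nonneg _) (hC s _ hs) 2
    _ ≤ _ := by
        rw [integral_const_mul]
        exact mul_le_mul_of_nonneg_left w.integral_scaleDeriv_le (sq_nonneg C)

/-- The continuous versions converge in `C([s₁, s₂], V)` and the derivatives in `L²`. Completeness
of each `W_s` puts the limits in the fibres, and Fatou upgrades the convergence to the norm of `𝕎`.
-/
instance [∀ s, CompleteSpace (W s)] : CompleteSpace (MultiscaleSpace V W ρ) := by
  refine Metric.complete_of_convergent_controlled_sequences (fun n => (1 / 2) ^ n)
    (fun n => by positivity) fun u hu => ?_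
  have hu2 : ∀ n m, n ≤ m → ‖u n - u m‖ ^ 2 ≤ (1 / 4) ^ n := by
    intro n m hnm
    have h := pow_le_pow_left₀ dist_nonneg (hu n n m le_rfl hnm).le 2
    rw [dist_eq_norm] at h
    refine h.trans_eq ?_
    rw [← pow_mul, mul_comm, pow_mul]
    norm_num
  have hcauchy : CauchySeq u := by
    refine cauchySeq_of_le_tendsto_0 (fun n => (1 / 2 : ℝ) ^ n)
      (fun n m N hn hm => (hu N n m hn hm).le)
      (tendsto_pow_atTop_nhds_zero_of_lt_one (by norm_num) (by norm_num))
  obtain ⟨A, hA0, hA⟩ := exists_sup_bound V W ρ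
  obtain ⟨B, hB0, hB⟩ := exists_norm_scaleDeriv_le V W ρ
  have htoMap : UniformContinuous (toMap : MultiscaleSpace V W ρ → _) := by
    refine (LipschitzWith.of_dist_le_mul (K := A.toNNReal) fun w w' => ?_).uniformContinuous
    rw [dist_eq_norm, dist_eq_norm, ← toMap_sub, Real.coe_toNNReal _ hA0]
    exact (ContinuousMap.norm_le _ (by positivity)).2 fun s => hA _ s
  obtain ⟨v, hv⟩ := cauchySeq_tendsto_of_complete (htoMap.comp_cauchySeq hcauchy)
  have hscaleDeriv : UniformContinuous (scaleDeriv : MultiscaleSpace V W ρ → _) := by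
    refine (LipschitzWith.of_dist_le_mul (K := B.toNNReal) fun w w' => ?_).uniformContinuous
    rw [dist_eq_norm, dist_eq_norm, ← scaleDeriv_sub, Real.coe_toNNReal _ hB0]
    exact hB _
  obtain ⟨g, hg⟩ := cauchySeq_tendsto_of_complete (hscaleDeriv.comp_cauchySeq hcauchy)
  obtain ⟨h1, h1'⟩ := ScaleSquareIntegrable.of_tendsto (W := W) (ν := ρ)
    (u := fun n => (u n).toMap) (u' := v) MultiscaleFamily.measurable_rho
    (fun n => (u n).toMap.continuous.stronglyMeasurable) v.continuous.stronglyMeasurable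
    (fun n => (u n).squareIntegrable_toMap)
    (fun n m hnm => (integral_toMap_sub_le _ _).trans (hu2 n m hnm)) tendsto_id
    (Eventually.of_forall fun s => ((continuous_eval_const s).tendsto v).comp hv)
  -- Convergence in `L²` is pointwise almost everywhere only along a subsequence, which still
  -- identifies the limits in `W_s`.
  obtain ⟨ns, hns, hlim⟩ := (tendstoInMeasure_of_tendsto_Lp hg).exists_seq_tendsto_ae
  obtain ⟨h2, h2'⟩ := ScaleSquareIntegrable.of_tendsto (W := W) (ν := lebesgue s₁ s₂)
    (u := fun n => (u n).scaleDeriv) (u' := g) (MultiscaleFamily.measurable_lebesgue ρ)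
    (fun n => Lp.stronglyMeasurable _) (Lp.stronglyMeasurable _)
    (fun n => (u n).squareIntegrable_scaleDeriv)
    (fun n m hnm => (integral_scaleDeriv_sub _ _).symm.le.trans
      ((integral_scaleDeriv_le _).trans (hu2 n m hnm))) hns.tendsto_atTop hlim
  let w : MultiscaleSpace V W ρ :=
    ⟨(v, g), HasWeakDeriv.of_tendsto (fun n => (u n).hasWeakDeriv) hv hg, h1, h2⟩
  refine ⟨w, ?_⟩
  rw [tendsto_iff_norm_sub_tendsto_zero]
  have h3 : ∀ n, ‖u n - w‖ ^ 2 ≤ 2 * (1 / 4) ^ n := by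
    intro n
    rw [norm_sq_eq, integral_scaleDeriv_sub, two_mul]
    exact add_le_add (h1' n) (h2' n)
  have h4 : Tendsto (fun n => ‖u n - w‖ ^ 2) atTop (𝓝 0) := by
    refine squeeze_zero (fun n => by positivity) h3 ?_
    simpa using (tendsto_pow_atTop_nhds_zero_of_lt_one (r := (1 / 4 : ℝ)) (by norm_num)
      (by norm_num)).const_mul 2
  simpa [Function.comp_def, Real.sqrt_sq] using (Real.continuous_sqrt.tendsto 0).comp h4

end MultiscaleSpace

end Completeness

/-! ### Integral equations with a square integrable Lipschitz constant -/

section IntegralEquations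

open scoped unitInterval

lemma setIntegral_Iic_exp_le {k : ℝ} (hk : 0 < k) (t : I) :
    ∫ τ in Iic t, Real.exp (k * τ) ≤ Real.exp (k * t) / k := by
  have h := setIntegral_Iic_lebesgue (s₁ := 0) (s₂ := 1) (fun x => Real.exp (k * x)) t
  have h1 : ∫ x in (0 : ℝ)..t, Real.exp (k * x) = (Real.exp (k * t) - 1) / k := by
    rw [intervalIntegral.integral_comp_mul_left (fun x => Real.exp x) hk.ne', integral_exp]
    simp [div_eq_inv_mul]
  refine (h.trans h1).trans_le ?_
  gcongr
  linarith

/-- Exponential weights with a large exponent compensate a kernel in `L²`. -/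
lemma setIntegral_mul_le_exp {a δ : I → ℝ} (ha : MemLp a 2) (ha0 : ∀ τ, 0 ≤ a τ) {B : ℝ}
    (hB : ∫ τ, a τ ^ 2 ≤ B ^ 2) (hδ0 : ∀ τ, 0 ≤ δ τ) {m : ℝ}
    (hδ : ∀ τ : I, δ τ ≤ m * Real.exp ((2 * B ^ 2 + 1) * τ)) (t : I) :
    ∫ τ in Iic t, a τ * δ τ ≤ m * Real.exp ((2 * B ^ 2 + 1) * t) / 2 := by
  -- This exponent makes `B² / (2k) ≤ 1/4`, hence the factor `1/2` after taking roots in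
  -- Cauchy–Schwarz.
  set k := 2 * B ^ 2 + 1 with hk
  have hk0 : 0 < k := by positivity
  have hm : 0 ≤ m := by simpa using (hδ0 0).trans (hδ 0)
  have hec : Continuous fun τ : I => Real.exp (k * τ) := by fun_prop
  have he : MemLp (fun τ : I => Real.exp (k * τ)) 2 :=
    hec.memLp_of_hasCompactSupport (HasCompactSupport.of_compactSpace _)
  have h1 : ∫ τ in Iic t, a τ * δ τ ≤ m * ∫ τ in Iic t, a τ * Real.exp (k * τ) := by
    rw [← integral_const_mul]
    refine integral_mono_of_nonneg (Eventually.of_forall fun τ => mul_nonneg (ha0 τ) (hδ0 τ))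
      ((ha.integrable_mul he).integrableOn.const_mul m) (Eventually.of_forall fun τ => ?_)
    calc a τ * δ τ ≤ a τ * (m * Real.exp (k * τ)) := mul_le_mul_of_nonneg_left (hδ τ) (ha0 τ)
      _ = _ := by simp only []; ring
  have h2 := integral_mul_sq_le (ha.restrict (Iic t)) (he.restrict (Iic t)) ha0
    (fun τ => (Real.exp_pos _).le)
  have h3 : ∫ τ in Iic t, a τ ^ 2 ≤ B ^ 2 :=
    (setIntegral_le_integral ha.integrable_sq (Eventually.of_forall fun x => by positivity)).trans hB
  have h4 : ∫ τ in Iic t, Real.exp (k * τ) ^ 2 ≤ Real.exp (k * t) ^ 2 / (2 * k) := by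
    have h := setIntegral_Iic_exp_le (k := 2 * k) (by positivity) t
    have e : ∀ τ : ℝ, Real.exp (k * τ) ^ 2 = Real.exp (2 * k * τ) := fun τ => by
      rw [← Real.exp_nat_mul]; ring_nf
    simpa only [e] using h
  have h5 : (∫ τ in Iic t, a τ * Real.exp (k * τ)) ^ 2 ≤ (Real.exp (k * t) / 2) ^ 2 := by
    calc _ ≤ B ^ 2 * (Real.exp (k * t) ^ 2 / (2 * k)) :=
          h2.trans (mul_le_mul h3 h4 (integral_nonneg fun x => by positivity) (by positivity))
      _ = (B ^ 2 / (2 * k)) * Real.exp (k * t) ^ 2 := by ring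
      _ ≤ (1 / 4) * Real.exp (k * t) ^ 2 := by
          refine mul_le_mul_of_nonneg_right ?_ (by positivity)
          rw [div_le_iff₀ (by positivity)]
          linarith
      _ = _ := by ring
  have h6 := abs_le_of_sq_le_sq' h5 (by positivity)
  calc _ ≤ m * (Real.exp (k * t) / 2) := h1.trans (mul_le_mul_of_nonneg_left h6.2 hm)
    _ = _ := by ring

/-- Grönwall's inequality in integral form, with a kernel in `L²`. -/
lemma le_of_le_add_setIntegral_mul {a δ : I → ℝ} (ha : MemLp a 2) (ha0 : ∀ τ, 0 ≤ a τ) {B : ℝ}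
    (hB : ∫ τ, a τ ^ 2 ≤ B ^ 2) (hδc : Continuous δ) (hδ0 : ∀ τ, 0 ≤ δ τ) {ε : ℝ}
    (hε : 0 ≤ ε) (h : ∀ t, δ t ≤ ε + ∫ τ in Iic t, a τ * δ τ) (t : I) :
    δ t ≤ 2 * ε * Real.exp (2 * B ^ 2 + 1) := by
  set k := 2 * B ^ 2 + 1 with hk
  have hk0 : 0 < k := by positivity
  have hcont : Continuous fun τ : I => δ τ * Real.exp (-(k * τ)) := by fun_prop
  -- At the maximum of `δ(τ) e^{-kτ}` the integral term is at most `δ(t₀) / 2` and can be absorbed.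
  obtain ⟨t₀, -, ht₀⟩ := isCompact_univ.exists_isMaxOn univ_nonempty hcont.continuousOn
  set m := δ t₀ * Real.exp (-(k * t₀)) with hm
  have hδ : ∀ τ : I, δ τ ≤ m * Real.exp (k * τ) := fun τ => by
    have h1 : δ τ * Real.exp (-(k * τ)) ≤ m := ht₀ (mem_univ τ)
    rwa [Real.exp_neg, mul_inv_le_iff₀ (Real.exp_pos _)] at h1
  have h1 : δ t₀ ≤ ε + m * Real.exp (k * t₀) / 2 :=
    (h t₀).trans (add_le_add_right (setIntegral_mul_le_exp ha ha0 hB hδ0 hδ t₀) ε)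
  have h2 : m * Real.exp (k * t₀) = δ t₀ := by
    rw [hm, mul_assoc, ← Real.exp_add]
    simp
  have h3 : δ t₀ ≤ 2 * ε := by linarith
  have h4 : m ≤ 2 * ε := by
    calc m ≤ δ t₀ * 1 := by
          rw [hm]
          refine mul_le_mul_of_nonneg_left (Real.exp_le_one_iff.2 ?_) (hδ0 t₀)
          exact neg_nonpos.2 (mul_nonneg hk0.le t₀.2.1)
      _ ≤ 2 * ε := by rwa [mul_one]
  refine (hδ t).trans (mul_le_mul h4 (Real.exp_le_exp.2 ?_) (Real.exp_pos _).le (by linarith))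
  exact mul_le_of_le_one_right hk0.le t.2.2

/-- Existence for the integral equation `φ(t) = x + ∫₀ᵗ f(τ, φ(τ)) dτ` with a right-hand side which
is Lipschitz in space with an `L²` constant. -/
lemma exists_integral_equation {E : Type*} [NormedAddCommGroup E] [NormedSpace ℝ E]
    [CompleteSpace E] {f : I → E → E} {a : I → ℝ} (ha : MemLp a 2)
    (hfm : ∀ φ : C(I, E), AEStronglyMeasurable (fun τ => f τ (φ τ)) volume)
    (hfb : ∀ τ x, ‖f τ x‖ ≤ a τ) (hfl : ∀ τ x y, ‖f τ x - f τ y‖ ≤ a τ * ‖x - y‖) (x : E) :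
    ∃ φ : C(I, E), ∀ t, φ t = x + ∫ τ in Iic t, f τ (φ τ) := by
  have ha0 : ∀ τ, 0 ≤ a τ := fun τ => (norm_nonneg _).trans (hfb τ 0)
  have hint : ∀ φ : C(I, E), Integrable (fun τ => f τ (φ τ)) := fun φ =>
    (ha.integrable (by norm_num)).mono' (hfm φ) (Eventually.of_forall fun τ => hfb τ _)
  set B := √(∫ τ, a τ ^ 2) with hBdef
  have hB : ∫ τ, a τ ^ 2 ≤ B ^ 2 :=
    (Real.sq_sqrt (integral_nonneg fun τ => by positivity)).ge
  set k := 2 * B ^ 2 + 1 with hk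
  let e : C(I, ℝ) := ⟨fun τ => Real.exp (k * τ), by fun_prop⟩
  let e' : C(I, ℝ) := ⟨fun τ => Real.exp (-(k * τ)), by fun_prop⟩
  have hee : ∀ τ, e τ * e' τ = 1 := fun τ => by
    change Real.exp _ * Real.exp _ = 1
    rw [← Real.exp_add]; simp
  have he0 : ∀ τ, 0 ≤ e τ := fun τ => (Real.exp_pos _).le
  let T : C(I, E) → C(I, E) := fun φ =>
    ⟨fun t => x + ∫ τ in Iic t, f τ (φ τ),
      continuous_const.add (continuous_setIntegral_Iic (μ := lebesgue 0 1) (hint φ))⟩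
  -- Conjugating the Picard operator `T` by the exponential weight makes it a contraction for the
  -- plain sup norm; multiplying its fixed point by `e` gives one of `T`.
  let S : C(I, E) → C(I, E) := fun ψ => e' • T (e • ψ)
  have hS : ContractingWith (1 / 2) S := by
    refine ⟨by norm_num, LipschitzWith.of_dist_le_mul fun ψ ψ' => ?_⟩
    rw [dist_eq_norm]
    refine (ContinuousMap.norm_le _ (by positivity)).2 fun t => ?_
    have h1 : (S ψ - S ψ') t = e' t • ∫ τ in Iic t, (f τ ((e • ψ) τ) - f τ ((e • ψ') τ)) := by
      rw [integral_sub (hint (e • ψ)).integrableOn (hint (e • ψ')).integrableOn]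
      change e' t • (x + ∫ τ in Iic t, f τ ((e • ψ) τ)) -
        e' t • (x + ∫ τ in Iic t, f τ ((e • ψ') τ)) = _
      rw [← smul_sub, add_sub_add_left_eq_sub]
    have h2 : ‖∫ τ in Iic t, (f τ ((e • ψ) τ) - f τ ((e • ψ') τ))‖ ≤
        ∫ τ in Iic t, a τ * (dist ψ ψ' * e τ) := by
      refine norm_integral_le_of_norm_le (Integrable.integrableOn ?_)
        (Eventually.of_forall fun τ => (hfl τ _ _).trans ?_)
      · have he : MemLp (fun τ => dist ψ ψ' * e τ) 2 (volume : Measure I) :=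
          (continuous_const.mul e.continuous).memLp_of_hasCompactSupport
            (HasCompactSupport.of_compactSpace _)
        exact ha.integrable_mul he
      · refine mul_le_mul_of_nonneg_left ?_ (ha0 τ)
        change ‖e τ • ψ τ - e τ • ψ' τ‖ ≤ _
        rw [← smul_sub, norm_smul, Real.norm_of_nonneg (he0 τ), mul_comm,
          ← dist_eq_norm]
        exact mul_le_mul_of_nonneg_right (ContinuousMap.dist_apply_le_dist τ) (Real.exp_pos _).le
    have h3 := setIntegral_mul_le_exp ha ha0 hB
      (δ := fun τ => dist ψ ψ' * e τ) (fun τ => mul_nonneg dist_nonneg (Real.exp_pos _).le)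
      (fun τ => le_rfl) t
    have he' : 0 ≤ e' t := (Real.exp_pos _).le
    rw [h1, norm_smul, Real.norm_of_nonneg he']
    calc _ ≤ e' t * (dist ψ ψ' * e t / 2) := mul_le_mul_of_nonneg_left (h2.trans h3) he'
      _ = (e t * e' t) * (dist ψ ψ' / 2) := by ring
      _ = _ := by rw [hee]; norm_num; ring
  refine ⟨e • ContractingWith.fixedPoint S hS, fun t => ?_⟩
  have hfix : S (ContractingWith.fixedPoint S hS) = _ := hS.fixedPoint_isFixedPt
  have h1 : (e • ContractingWith.fixedPoint S hS) t =
      e t • S (ContractingWith.fixedPoint S hS) t := by rw [hfix]; rfl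
  rw [h1]
  change e t • e' t • T _ t = T _ t
  rw [smul_smul, hee, one_smul]

end IntegralEquations

/-! ### Flows: existence, stability and weak continuity -/

section Flows

open scoped unitInterval

variable {d : ℕ} {s₁ s₂ : ℝ}
  {V : Type*} [NormedAddCommGroup V] [InnerProductSpace ℝ V] [CompleteSpace V]
  [RKHS ℝ V (Vec d) (Vec d)]
  {W : Icc s₁ s₂ → Type*} [∀ s, NormedAddCommGroup (W s)]
  [∀ s, InnerProductSpace ℝ (W s)] [∀ s, RKHS ℝ (W s) (Vec d) (Vec d)]
  {ρ : Measure (Icc s₁ s₂)} [MultiscaleFamily V W ρ]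

section FieldBound

variable (V W ρ)

/-- A constant bounding the fields `w(s, ·)`, their Lipschitz constants and their Hölder constants
in the scale `s` in terms of the norm of `w ∈ 𝕎`. -/
def fieldBound : ℝ := (MultiscaleSpace.exists_field_bound V W ρ).choose

lemma fieldBound_nonneg : 0 ≤ fieldBound V W ρ :=
  (MultiscaleSpace.exists_field_bound V W ρ).choose_spec.1

variable {V W ρ}

namespace MultiscaleSpace

lemma norm_apply_le (w : MultiscaleSpace V W ρ) (s : Icc s₁ s₂) (x : Vec d) :
    ‖w.toMap s x‖ ≤ fieldBound V W ρ * ‖w‖ :=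
  (exists_field_bound V W ρ).choose_spec.2.1 w s x

lemma norm_apply_sub_le (w : MultiscaleSpace V W ρ) (s : Icc s₁ s₂) (x y : Vec d) :
    ‖w.toMap s x - w.toMap s y‖ ≤ fieldBound V W ρ * ‖w‖ * ‖x - y‖ :=
  (exists_field_bound V W ρ).choose_spec.2.2.1 w s x y

lemma norm_scale_sub_le (w : MultiscaleSpace V W ρ) (r s : Icc s₁ s₂) (x : Vec d) :
    ‖w.toMap s x - w.toMap r x‖ ≤ fieldBound V W ρ * ‖w‖ * √|(s : ℝ) - r| :=
  (exists_field_bound V W ρ).choose_spec.2.2.2 w r s x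

/-- Joint continuity makes `τ ↦ v(τ, s, φ(τ))` measurable in time along continuous curves. -/
lemma continuous_eval (s : Icc s₁ s₂) :
    Continuous fun p : MultiscaleSpace V W ρ × Vec d => p.1.toMap s p.2 := by
  rw [continuous_iff_continuousAt]
  rintro ⟨w, x⟩
  rw [ContinuousAt, tendsto_iff_norm_sub_tendsto_zero]
  have hb : Continuous fun p : MultiscaleSpace V W ρ × Vec d =>
      fieldBound V W ρ * ‖p.1 - w‖ + fieldBound V W ρ * ‖w‖ * ‖p.2 - x‖ := by fun_prop
  refine squeeze_zero (fun p => norm_nonneg _) (fun p => ?_)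
    (by simpa using hb.tendsto (w, x))
  calc ‖p.1.toMap s p.2 - w.toMap s x‖
      = ‖(p.1 - w).toMap s p.2 + (w.toMap s p.2 - w.toMap s x)‖ := by
        rw [sub_apply, sub_add_sub_cancel]
    _ ≤ _ := (norm_add_le _ _).trans
        (add_le_add (norm_apply_le _ _ _) (norm_apply_sub_le _ _ _ _))

end MultiscaleSpace

end FieldBound

lemma aestronglyMeasurable_field_comp (v : TimeScaleFields V W ρ) (s : Icc s₁ s₂) {φ : I → Vec d}
    (hφ : Continuous φ) : AEStronglyMeasurable (fun τ => (v τ).toMap s (φ τ)) volume :=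
  (MultiscaleSpace.continuous_eval s).comp_aestronglyMeasurable
    ((Lp.aestronglyMeasurable v).prodMk hφ.aestronglyMeasurable)

lemma memLp_fieldBound (v : TimeScaleFields V W ρ) :
    MemLp (fun τ => fieldBound V W ρ * ‖v τ‖) 2 (volume : Measure I) :=
  (Lp.memLp v).norm.const_mul _

lemma integral_fieldBound_sq (v : TimeScaleFields V W ρ) :
    ∫ τ, (fieldBound V W ρ * ‖v τ‖) ^ 2 = (fieldBound V W ρ * ‖v‖) ^ 2 := by
  simp only [mul_pow]
  rw [integral_const_mul, Lp_norm_sq]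

lemma integrable_field_comp (v : TimeScaleFields V W ρ) (s : Icc s₁ s₂) {φ : I → Vec d}
    (hφ : Continuous φ) : Integrable (fun τ => (v τ).toMap s (φ τ)) :=
  ((memLp_fieldBound v).integrable (by norm_num)).mono' (aestronglyMeasurable_field_comp v s hφ)
    (Eventually.of_forall fun τ => (v τ).norm_apply_le s _)

/-- An integral over a set of times is controlled by the `L²` norm of the field. -/
lemma norm_setIntegral_field_le (v : TimeScaleFields V W ρ) {f : I → Vec d} {c : ℝ} (hc : 0 ≤ c)
    (S : Set I) (hf : ∀ τ, ‖f τ‖ ≤ fieldBound V W ρ * ‖v τ‖ * c) :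
    ‖∫ τ in S, f τ‖ ≤ √(volume.real S) * (fieldBound V W ρ * ‖v‖ * c) := by
  have hC := fieldBound_nonneg V W ρ
  refine norm_setIntegral_le_of_norm_le_sq ((memLp_fieldBound v).mul_const c)
    (fun τ => by positivity) (by positivity) ?_ S (Eventually.of_forall hf)
  simp only [mul_pow _ c]
  rw [integral_mul_const, integral_fieldBound_sq]

lemma norm_setIntegral_field_le' (v : TimeScaleFields V W ρ) {f : I → Vec d} {c : ℝ} (hc : 0 ≤ c)
    (S : Set I) (hf : ∀ τ, ‖f τ‖ ≤ fieldBound V W ρ * ‖v τ‖ * c) :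
    ‖∫ τ in S, f τ‖ ≤ fieldBound V W ρ * ‖v‖ * c := by
  have hC := fieldBound_nonneg V W ρ
  refine (norm_setIntegral_field_le v hc S hf).trans (mul_le_of_le_one_left (by positivity) ?_)
  rw [Real.sqrt_le_one]
  exact measureReal_le_one

lemma IsFlow.continuous_time {v : TimeScaleFields V W ρ} {φ : I → Icc s₁ s₂ → Vec d → Vec d}
    (h : IsFlow v φ) (s : Icc s₁ s₂) (x : Vec d) : Continuous fun t => φ t s x := by
  have h1 : (fun t => φ t s x) = fun t => x + ∫ τ in Iic t, (v τ).toMap s (φ τ s x) :=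
    funext (h s x).2
  rw [h1]
  exact continuous_const.add (continuous_setIntegral_Iic (μ := lebesgue 0 1) (h s x).1)

/-- Stability of the flow equation: a curve which satisfies it up to an error `ε` is close to the
flow. -/
lemma IsFlow.norm_sub_le {v : TimeScaleFields V W ρ} {φ : I → Icc s₁ s₂ → Vec d → Vec d}
    (h : IsFlow v φ) (s : Icc s₁ s₂) (x : Vec d) {ψ : I → Vec d} (hψ : Continuous ψ) {ε : ℝ}
    (hε : 0 ≤ ε) (hψε : ∀ t, ‖ψ t - (x + ∫ τ in Iic t, (v τ).toMap s (ψ τ))‖ ≤ ε) (t : I) :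
    ‖φ t s x - ψ t‖ ≤ 2 * ε * Real.exp (2 * (fieldBound V W ρ * ‖v‖) ^ 2 + 1) := by
  have hC := fieldBound_nonneg V W ρ
  have hφ := h.continuous_time s x
  refine le_of_le_add_setIntegral_mul (δ := fun t => ‖φ t s x - ψ t‖) (memLp_fieldBound v)
    (fun τ => by positivity) (integral_fieldBound_sq v).le (hφ.sub hψ).norm
    (fun τ => norm_nonneg _) hε (fun t => ?_) t
  have h1 : φ t s x - ψ t = -(ψ t - (x + ∫ τ in Iic t, (v τ).toMap s (ψ τ))) +
      ∫ τ in Iic t, ((v τ).toMap s (φ τ s x) - (v τ).toMap s (ψ τ)) := by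
    rw [integral_sub (integrable_field_comp v s hφ).integrableOn (integrable_field_comp v s hψ).integrableOn,
      (h s x).2 t]
    abel
  have h2 : Integrable (fun τ => fieldBound V W ρ * ‖v τ‖ * ‖φ τ s x - ψ τ‖) volume :=
    (memLp_fieldBound v).integrable_mul (q := 2) ((hφ.sub hψ).norm.memLp_of_hasCompactSupport
      (HasCompactSupport.of_compactSpace _))
  simp only [h1]
  refine (norm_add_le _ _).trans (add_le_add ?_ ?_)
  · rw [norm_neg]
    exact hψε t
  · exact norm_integral_le_of_norm_le h2.integrableOn
      (Eventually.of_forall fun τ => (v τ).norm_apply_sub_le s _ _)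

/-- Stability with error zero; the integrability required of a flow makes its trajectories
continuous, as Grönwall demands. -/
lemma IsFlow.unique {v : TimeScaleFields V W ρ} {φ ψ : I → Icc s₁ s₂ → Vec d → Vec d}
    (h : IsFlow v φ) (h' : IsFlow v ψ) : φ = ψ := by
  funext t s x
  have h1 := h.norm_sub_le s x (h'.continuous_time s x) le_rfl
    (fun t => by rw [(h' s x).2 t, sub_self, norm_zero]) t
  rwa [mul_zero, zero_mul, norm_le_zero_iff, sub_eq_zero] at h1

lemma exists_isFlow (v : TimeScaleFields V W ρ) : ∃ φ, IsFlow v φ := by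
  choose φ hφ using fun (s : Icc s₁ s₂) (x : Vec d) =>
    exists_integral_equation (f := fun τ => (v τ).toMap s) (memLp_fieldBound v)
      (fun φ => aestronglyMeasurable_field_comp v s φ.continuous)
      (fun τ x => (v τ).norm_apply_le s x) (fun τ x y => (v τ).norm_apply_sub_le s x y) x
  exact ⟨fun t s x => φ s x t, fun s x =>
    ⟨integrable_field_comp v s (φ s x).continuous, fun t => hφ s x t⟩⟩

lemma isFlow_flow (v : TimeScaleFields V W ρ) : IsFlow v (flow v) :=
  Classical.epsilon_spec (exists_isFlow v)

/-- The flow depends continuously on the scale and the initial point, uniformly in time. -/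
lemma norm_flow_sub_le (v : TimeScaleFields V W ρ) (r s : Icc s₁ s₂) (x y : Vec d) (t : I) :
    ‖flow v t s x - flow v t r y‖ ≤
      2 * (‖x - y‖ + fieldBound V W ρ * ‖v‖ * √|(s : ℝ) - r|) *
        Real.exp (2 * (fieldBound V W ρ * ‖v‖) ^ 2 + 1) := by
  have hC := fieldBound_nonneg V W ρ
  have hc := (isFlow_flow v).continuous_time r y
  refine (isFlow_flow v).norm_sub_le s x hc (by positivity) (fun t => ?_) t
  -- The trajectory from `y` at scale `r` solves the equation for `(s, x)` up to the change of
  -- initial point and of scale.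
  have h1 : flow v t r y - (x + ∫ τ in Iic t, (v τ).toMap s (flow v τ r y)) = -(x - y) -
      ∫ τ in Iic t, ((v τ).toMap s (flow v τ r y) - (v τ).toMap r (flow v τ r y)) := by
    rw [integral_sub (integrable_field_comp v s hc).integrableOn (integrable_field_comp v r hc).integrableOn]
    conv_lhs => rw [((isFlow_flow v) r y).2 t]
    abel
  rw [h1]
  refine (norm_sub_le _ _).trans (add_le_add (norm_neg _).le ?_)
  exact norm_setIntegral_field_le' v (Real.sqrt_nonneg _) _ fun τ => (v τ).norm_scale_sub_le r s _

/-- The displacement `w ↦ ∫₀ᵗ w(τ, s, ψ(τ)) dτ` along a fixed curve, as a bounded linear map. -/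
def displacement (s : Icc s₁ s₂) (ψ : C(I, Vec d)) (t : I) : TimeScaleFields V W ρ →L[ℝ] Vec d :=
  LinearMap.mkContinuous
    { toFun := fun w => ∫ τ in Iic t, (w τ).toMap s (ψ τ)
      map_add' := fun w w' => by
        rw [← integral_add (integrable_field_comp w s ψ.continuous).integrableOn
          (integrable_field_comp w' s ψ.continuous).integrableOn]
        refine integral_congr_ae (ae_restrict_of_ae ?_)
        filter_upwards [Lp.coeFn_add w w'] with τ hτ
        rw [hτ, Pi.add_apply]
        change ((w τ).toMap s + (w' τ).toMap s) (ψ τ) = _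
        rw [RKHS.coe_add, Pi.add_apply]
      map_smul' := fun c w => by
        rw [RingHom.id_apply, ← integral_smul]
        refine integral_congr_ae (ae_restrict_of_ae ?_)
        filter_upwards [Lp.coeFn_smul c w] with τ hτ
        rw [hτ, Pi.smul_apply]
        change (c • (w τ).toMap s) (ψ τ) = _
        rw [RKHS.coe_smul, Pi.smul_apply] }
    (fieldBound V W ρ) fun w => by
      have := norm_setIntegral_field_le' w zero_le_one (f := fun τ => (w τ).toMap s (ψ τ)) (Iic t)
        fun τ => by rw [mul_one]; exact (w τ).norm_apply_le s _
      rwa [mul_one] at this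

lemma displacement_apply (s : Icc s₁ s₂) (ψ : C(I, Vec d)) (t : I) (w : TimeScaleFields V W ρ) :
    displacement s ψ t w = ∫ τ in Iic t, (w τ).toMap s (ψ τ) := rfl

lemma norm_displacement_sub_time_le (s : Icc s₁ s₂) (ψ : C(I, Vec d)) (t t' : I)
    (w : TimeScaleFields V W ρ) :
    ‖displacement s ψ t w - displacement s ψ t' w‖ ≤
      fieldBound V W ρ * ‖w‖ * √|(t : ℝ) - t'| := by
  wlog h : t' ≤ t generalizing t t'
  · rw [norm_sub_rev, abs_sub_comm]
    exact this t' t (le_of_not_ge h)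
  rw [displacement_apply, displacement_apply, setIntegral_Iic_sub (integrable_field_comp w s ψ.continuous) h]
  refine (norm_setIntegral_field_le w zero_le_one (Ioc t' t) fun τ => ?_).trans_eq ?_
  · rw [mul_one]
    exact (w τ).norm_apply_le s _
  · have : volume.real (Ioc t' t) = (t : ℝ) - t' := lebesgue_Ioc_real h
    rw [this, abs_of_nonneg (sub_nonneg.2 (Subtype.coe_le_coe.2 h))]
    ring

lemma norm_displacement_sub_le (r s : Icc s₁ s₂) (ψ χ : C(I, Vec d)) (t : I)
    (w : TimeScaleFields V W ρ) :
    ‖displacement s ψ t w - displacement r χ t w‖ ≤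
      fieldBound V W ρ * ‖w‖ * (√|(s : ℝ) - r| + ‖ψ - χ‖) := by
  have hC := fieldBound_nonneg V W ρ
  rw [displacement_apply, displacement_apply, ← integral_sub
    (integrable_field_comp w s ψ.continuous).integrableOn (integrable_field_comp w r χ.continuous).integrableOn]
  refine norm_setIntegral_field_le' w (by positivity) _ fun τ => ?_
  calc ‖(w τ).toMap s (ψ τ) - (w τ).toMap r (χ τ)‖
      = ‖((w τ).toMap s (ψ τ) - (w τ).toMap r (ψ τ)) +
          ((w τ).toMap r (ψ τ) - (w τ).toMap r (χ τ))‖ := by rw [sub_add_sub_cancel]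
    _ ≤ fieldBound V W ρ * ‖w τ‖ * √|(s : ℝ) - r| + fieldBound V W ρ * ‖w τ‖ * ‖ψ τ - χ τ‖ :=
        (norm_add_le _ _).trans
          (add_le_add ((w τ).norm_scale_sub_le r s _) ((w τ).norm_apply_sub_le r _ _))
    _ ≤ fieldBound V W ρ * ‖w τ‖ * √|(s : ℝ) - r| + fieldBound V W ρ * ‖w τ‖ * ‖ψ - χ‖ := by
        gcongr
        exact (ψ - χ).norm_coe_le_norm τ
    _ = _ := by ring

/-- The trajectories of the flow. -/
def trajectory (v : TimeScaleFields V W ρ) (s : Icc s₁ s₂) (x : Vec d) : C(I, Vec d) :=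
  ⟨fun t => flow v t s x, (isFlow_flow v).continuous_time s x⟩

/-- Needed in sup norm over time, so that displacements along trajectories vary continuously with
the scale and the starting point. -/
lemma continuous_trajectory (v : TimeScaleFields V W ρ) :
    Continuous fun p : Icc s₁ s₂ × Vec d => trajectory v p.1 p.2 := by
  have hC := fieldBound_nonneg V W ρ
  rw [continuous_iff_continuousAt]
  rintro ⟨r, y⟩
  rw [ContinuousAt, tendsto_iff_norm_sub_tendsto_zero]
  have hb : Continuous fun p : Icc s₁ s₂ × Vec d =>
      2 * (‖p.2 - y‖ + fieldBound V W ρ * ‖v‖ * √|(p.1 : ℝ) - r|) *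
        Real.exp (2 * (fieldBound V W ρ * ‖v‖) ^ 2 + 1) := by fun_prop
  exact squeeze_zero (fun p => norm_nonneg _)
    (fun p => (ContinuousMap.norm_le _ (by positivity)).2 fun t => norm_flow_sub_le v r p.1 p.2 y t)
    (by simpa using hb.tendsto (r, y))

/-- The displacements of a bounded family of fields along the trajectories of a fixed flow are
equicontinuous. -/
lemma equicontinuous_displacement (v : TimeScaleFields V W ρ) {ι : Type*}
    {w : ι → TimeScaleFields V W ρ} {M : ℝ} (hM : ∀ i, ‖w i‖ ≤ M) :
    Equicontinuous fun i (p : I × Icc s₁ s₂ × Vec d) =>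
      displacement p.2.1 (trajectory v p.2.1 p.2.2) p.1 (w i) := by
  have hC := fieldBound_nonneg V W ρ
  intro q
  -- A modulus of continuity that involves the family only through the bound `M`.
  have hb : Continuous fun p : I × Icc s₁ s₂ × Vec d =>
      fieldBound V W ρ * M * √|(q.1 : ℝ) - p.1| + fieldBound V W ρ * M *
        (√|(q.2.1 : ℝ) - p.2.1| +
          ‖trajectory v q.2.1 q.2.2 - trajectory v p.2.1 p.2.2‖) := by
    have := (continuous_trajectory v).comp
      (continuous_snd : Continuous fun p : I × Icc s₁ s₂ × Vec d => p.2)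
    have h2 : Continuous fun p : I × Icc s₁ s₂ × Vec d => trajectory v p.2.1 p.2.2 := this
    fun_prop
  refine Metric.equicontinuousAt_of_continuity_modulus _ (by simpa using hb.tendsto q) _
    (Eventually.of_forall fun p i => ?_)
  rw [dist_eq_norm, ← sub_add_sub_cancel _
    (displacement q.2.1 (trajectory v q.2.1 q.2.2) p.1 (w i))]
  refine (norm_add_le _ _).trans (add_le_add ?_ ?_)
  · refine (norm_displacement_sub_time_le _ _ _ _ _).trans ?_
    gcongr
    exact hM i
  · refine (norm_displacement_sub_le _ _ _ _ _ _).trans ?_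
    gcongr
    exact hM i

/-- The distance of two flows in terms of the displacement by the difference of the fields. -/
lemma norm_flow_sub_flow_le (u v : TimeScaleFields V W ρ) (s : Icc s₁ s₂) (x : Vec d) {ε : ℝ}
    (h : ∀ t, ‖displacement s (trajectory v s x) t (u - v)‖ ≤ ε) (t : I) :
    ‖flow u t s x - flow v t s x‖ ≤
      2 * ε * Real.exp (2 * (fieldBound V W ρ * ‖u‖) ^ 2 + 1) := by
  refine (isFlow_flow u).norm_sub_le s x ((isFlow_flow v).continuous_time s x)
    ((norm_nonneg _).trans (h t)) (fun t => ?_) t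
  have h1 : flow v t s x - (x + ∫ τ in Iic t, (u τ).toMap s (flow v τ s x)) =
      -displacement s (trajectory v s x) t (u - v) := by
    rw [map_sub, displacement_apply, displacement_apply]
    conv_lhs => rw [((isFlow_flow v) s x).2 t]
    change (x + ∫ τ in Iic t, (v τ).toMap s (flow v τ s x)) -
      (x + ∫ τ in Iic t, (u τ).toMap s (flow v τ s x)) =
      -((∫ τ in Iic t, (u τ).toMap s (flow v τ s x)) - ∫ τ in Iic t, (v τ).toMap s (flow v τ s x))
    abel
  rw [h1, norm_neg]
  exact h t

/-- Weak convergence of a bounded family of fields implies locally uniform convergence of the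
flows. -/
theorem tendstoUniformlyOn_flow {ι : Type*} {l : Filter ι} {u : ι → TimeScaleFields V W ρ}
    {v : TimeScaleFields V W ρ} {M : ℝ} (hM : ∀ i, ‖u i‖ ≤ M)
    (hw : ∀ ℓ : StrongDual ℝ (TimeScaleFields V W ρ),
      Tendsto (fun i => ℓ (u i)) l (𝓝 (ℓ v)))
    {K : Set (Vec d)} (hK : IsCompact K) :
    TendstoUniformlyOn (fun i (p : I × Icc s₁ s₂ × Vec d) => flow (u i) p.1 p.2.1 p.2.2)
      (fun p => flow v p.1 p.2.1 p.2.2) l (univ ×ˢ univ ×ˢ K) := by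
  have hC := fieldBound_nonneg V W ρ
  set R : ι → I × Icc s₁ s₂ × Vec d → Vec d := fun i p =>
    displacement p.2.1 (trajectory v p.2.1 p.2.2) p.1 (u i - v) with hR
  have heq : Equicontinuous R := equicontinuous_displacement v (M := M + ‖v‖) fun i =>
    (norm_sub_le _ _).trans (add_le_add_left (hM i) _)
  have hpt : ∀ p, Tendsto (fun i => R i p) l (𝓝 0) := by
    intro p
    have h1 : Tendsto (fun i => displacement p.2.1 (trajectory v p.2.1 p.2.2) p.1 (u i)) l
        (𝓝 (displacement p.2.1 (trajectory v p.2.1 p.2.2) p.1 v)) := by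
      -- Each coordinate of the displacement is a continuous linear functional, to which weak
      -- convergence applies.
      rw [(PiLp.homeomorph 2 fun _ : Fin d => ℝ).isInducing.tendsto_nhds_iff, tendsto_pi_nhds]
      exact fun j => hw ((EuclideanSpace.proj j).comp
        (displacement p.2.1 (trajectory v p.2.1 p.2.2) p.1))
    have h2 := h1.sub_const (displacement p.2.1 (trajectory v p.2.1 p.2.2) p.1 v)
    rw [sub_self] at h2
    exact h2.congr fun i => (map_sub _ _ _).symm
  have hKc : IsCompact ((univ : Set I) ×ˢ (univ : Set (Icc s₁ s₂)) ×ˢ K) :=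
    isCompact_univ.prod (isCompact_univ.prod hK)
  have hunif : TendstoUniformlyOn R 0 l (univ ×ˢ univ ×ˢ K) := by
    -- On a compact set, pointwise convergence of an equicontinuous family is uniform.
    have h1 := (EquicontinuousOn.tendsto_uniformOnFun_iff_pi' (F := R) (ℱ := l) (f := 0)
      (𝔖 := {(univ : Set I) ×ˢ (univ : Set (Icc s₁ s₂)) ×ˢ K})
      (by rintro _ rfl; exact hKc) (fun _ _ => heq.equicontinuousOn _)).2
      (tendsto_pi_nhds.2 fun p => hpt p.1)
    exact (UniformOnFun.tendsto_iff_tendstoUniformlyOn.1 h1) _ rfl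
  set L := 2 * Real.exp (2 * (fieldBound V W ρ * M) ^ 2 + 1) with hL
  have hL0 : 0 < L := by positivity
  rw [Metric.tendstoUniformlyOn_iff] at hunif ⊢
  intro η hη
  -- `L` is the Grönwall factor at the norm bound `M`; this tolerance makes the final error `η / 2`.
  filter_upwards [hunif (η / (2 * L)) (by positivity)] with i hi p hp
  have h1 := norm_flow_sub_flow_le (u i) v p.2.1 p.2.2 (ε := η / (2 * L)) (fun t => by
    have := hi (t, p.2) ⟨mem_univ _, hp.2⟩
    rw [Pi.zero_apply, dist_zero_left] at this
    exact this.le) p.1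
  rw [dist_comm, dist_eq_norm]
  calc _ ≤ 2 * (η / (2 * L)) * Real.exp (2 * (fieldBound V W ρ * M) ^ 2 + 1) := by
        refine h1.trans ?_
        gcongr
        exact hM i
    _ = η / (2 * L) * L := by rw [hL]; ring
    _ = η / 2 := by field_simp
    _ < η := half_lt_self hη

end Flows

/-! ### Weak compactness and the direct method -/

section WeakCompactness

variable {E : Type*} [NormedAddCommGroup E] [InnerProductSpace ℝ E] [CompleteSpace E]

/-- Bounded families in a Hilbert space converge weakly along ultrafilters. -/
lemma exists_weak_limit {ι : Type*} (l : Ultrafilter ι) {u : ι → E} {M : ℝ}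
    (hM : ∀ i, ‖u i‖ ≤ M) :
    ∃ v : E, ∀ ℓ : StrongDual ℝ E, Tendsto (fun i => ℓ (u i)) l (𝓝 (ℓ v)) := by
  -- Banach–Alaoglu in the dual, carried to `E` by the Riesz isometry.
  have hK := WeakDual.isCompact_closedBall (𝕜 := ℝ) (0 : StrongDual ℝ E) M
  obtain ⟨f, -, hf⟩ := isCompact_iff_ultrafilter_le_nhds.1 hK
    (l.map fun i => StrongDual.toWeakDual (InnerProductSpace.toDual ℝ E (u i))) <| by
      rw [le_principal_iff]
      refine Filter.mem_map.2 (Filter.univ_mem' fun i => ?_)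
      simpa using hM i
  refine ⟨(InnerProductSpace.toDual ℝ E).symm (WeakDual.toStrongDual f), fun ℓ => ?_⟩
  have h1 : Tendsto (fun i => StrongDual.toWeakDual (InnerProductSpace.toDual ℝ E (u i))) l (𝓝 f) :=
    hf
  have h2 := ((WeakDual.eval_continuous ((InnerProductSpace.toDual ℝ E).symm ℓ)).tendsto f).comp h1
  have h3 : ∀ x : E, ℓ x = ⟪x, (InnerProductSpace.toDual ℝ E).symm ℓ⟫_ℝ := fun x => by
    rw [real_inner_comm, InnerProductSpace.toDual_symm_apply]
  simp only [h3]
  rw [InnerProductSpace.toDual_symm_apply]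
  exact h2

/-- The direct method of the calculus of variations in a Hilbert space, for the sum of
`½ ‖v‖²` and a functional which is bounded below and weakly lower semicontinuous on bounded sets. -/
theorem exists_minimizer_half_norm_sq_add {Ψ : E → ℝ} (hb : BddBelow (range Ψ))
    (hΨ : ∀ (l : Filter ℕ) (u : ℕ → E) (v : E), (∃ M : ℝ, ∀ n, ‖u n‖ ≤ M) →
      (∀ ℓ : StrongDual ℝ E, Tendsto (fun n => ℓ (u n)) l (𝓝 (ℓ v))) →
      ∀ c < Ψ v, ∀ᶠ n in l, c < Ψ (u n)) :
    ∃ v : E, ∀ w : E, 1 / 2 * ‖v‖ ^ 2 + Ψ v ≤ 1 / 2 * ‖w‖ ^ 2 + Ψ w := by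
  obtain ⟨b, hb⟩ := hb
  have hb' : ∀ v, b ≤ Ψ v := fun v => hb (mem_range_self v)
  set J : E → ℝ := fun v => 1 / 2 * ‖v‖ ^ 2 + Ψ v with hJ
  have hbdd : BddBelow (range J) := by
    refine ⟨b, ?_⟩
    rintro _ ⟨v, rfl⟩
    exact le_add_of_nonneg_of_le (by positivity) (hb' v)
  set m := ⨅ v, J v with hm
  have hm' : ∀ v, m ≤ J v := fun v => ciInf_le hbdd v
  choose u hu using fun n : ℕ => exists_lt_of_ciInf_lt (f := J)
    (lt_add_of_pos_right m (Nat.one_div_pos_of_nat (n := n) : (0 : ℝ) < 1 / (n + 1)))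
  have hlim : Tendsto (fun n => J (u n)) atTop (𝓝 m) := by
    refine tendsto_of_tendsto_of_tendsto_of_le_of_le tendsto_const_nhds ?_
      (fun n => hm' (u n)) (fun n => (hu n).le)
    simpa using tendsto_one_div_add_atTop_nhds_zero_nat.const_add m
  -- From `½ ‖u n‖² + b ≤ J (u n) < m + 1`.
  have hM : ∀ n, ‖u n‖ ≤ √(2 * (m + 1 - b)) := by
    intro n
    apply Real.le_sqrt_of_sq_le
    have h1 : (1 : ℝ) / (n + 1) ≤ 1 := by
      rw [div_le_one (by positivity)]
      linarith [(Nat.cast_nonneg n : (0 : ℝ) ≤ n)]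
    have h2 : 1 / 2 * ‖u n‖ ^ 2 + Ψ (u n) < m + 1 / (n + 1) := hu n
    linarith [hb' (u n)]
  -- A nonprincipal ultrafilter replaces the extraction of a weakly convergent subsequence.
  obtain ⟨v, hv⟩ := exists_weak_limit (hyperfilter ℕ) hM
  have hinner : Tendsto (fun n => ⟪v, u n⟫_ℝ) (hyperfilter ℕ) (𝓝 (‖v‖ ^ 2)) := by
    rw [← real_inner_self_eq_norm_sq]
    exact hv (InnerProductSpace.toDual ℝ E v)
  have hlim' := hlim.mono_left Nat.hyperfilter_le_atTop
  refine ⟨v, fun w => le_trans ?_ (hm' w)⟩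
  refine le_of_forall_pos_le_add fun ε hε => ?_
  -- Weak lower semicontinuity of the norm: `½ ‖u n‖² ≥ ⟪v, u n⟫ - ½ ‖v‖²`, whose right side tends
  -- to `½ ‖v‖²`.
  have h1 : ∀ᶠ n in (hyperfilter ℕ : Filter ℕ),
      ⟪v, u n⟫_ℝ - 1 / 2 * ‖v‖ ^ 2 + (Ψ v - ε) ≤ J (u n) := by
    filter_upwards [hΨ _ u v ⟨_, hM⟩ hv (Ψ v - ε) (sub_lt_self _ hε)] with n hn
    have h2 := norm_sub_sq_real v (u n)
    have h3 : J (u n) = 1 / 2 * ‖u n‖ ^ 2 + Ψ (u n) := rfl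
    nlinarith [sq_nonneg ‖v - u n‖]
  have h2 := le_of_tendsto_of_tendsto
    ((hinner.sub_const (1 / 2 * ‖v‖ ^ 2)).add_const (Ψ v - ε)) hlim' h1
  linarith

end WeakCompactness

/-! ### Weak continuity of the end map -/

section EndMap

open scoped unitInterval

variable {d : ℕ} {s₁ s₂ : ℝ}
  {V : Type*} [NormedAddCommGroup V] [InnerProductSpace ℝ V] [CompleteSpace V]
  [RKHS ℝ V (Vec d) (Vec d)]
  {W : Icc s₁ s₂ → Type*} [∀ s, NormedAddCommGroup (W s)]
  [∀ s, InnerProductSpace ℝ (W s)] [∀ s, RKHS ℝ (W s) (Vec d) (Vec d)]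
  {ρ : Measure (Icc s₁ s₂)} [MultiscaleFamily V W ρ]

/-- The end map is weakly continuous on bounded sets. -/
lemma tendsto_endMap {ι : Type*} {l : Filter ι} {u : ι → TimeScaleFields V W ρ}
    {v : TimeScaleFields V W ρ} {M : ℝ} (hM : ∀ i, ‖u i‖ ≤ M)
    (hw : ∀ ℓ : StrongDual ℝ (TimeScaleFields V W ρ),
      Tendsto (fun i => ℓ (u i)) l (𝓝 (ℓ v))) :
    Tendsto (fun i => endMap (u i)) l (𝓝 (endMap v)) := by
  rw [UniformOnFun.tendsto_iff_tendstoUniformlyOn]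
  intro K hK
  have h1 := tendstoUniformlyOn_flow hM hw (hK.image continuous_snd)
  have h2 := h1.comp fun p : Icc s₁ s₂ × Vec d => ((1 : I), p.1, p.2)
  exact h2.mono fun p hp => ⟨mem_univ _, mem_univ _, mem_image_of_mem _ hp⟩

end EndMap

end

/-! ### The main theorem -/

theorem mainTheorem1 {d : ℕ} {s₁ s₂ : ℝ} (hs₁ : 0 < s₁) (hs : s₁ < s₂)
    (V : Type*) [NormedAddCommGroup V] [InnerProductSpace ℝ V] [CompleteSpace V]
    [RKHS ℝ V (Vec d) (Vec d)]
    (W : Icc s₁ s₂ → Type*) [∀ s, NormedAddCommGroup (W s)] [∀ s, InnerProductSpace ℝ (W s)]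
    [∀ s, CompleteSpace (W s)] [∀ s, RKHS ℝ (W s) (Vec d) (Vec d)]
    (ρ : Measure (Icc s₁ s₂)) [MultiscaleFamily V W ρ] :
    -- the flows are well defined
    (∀ v : TimeScaleFields V W ρ, ∃! φ, IsFlow v φ) ∧
    -- weak convergence of the fields implies locally uniform convergence of the flows
    (∀ (u : ℕ → TimeScaleFields V W ρ) (v : TimeScaleFields V W ρ),
      (∃ M : ℝ, ∀ n, ‖u n‖ ≤ M) →
      Tendsto (fun n => toWeakSpace ℝ (TimeScaleFields V W ρ) (u n)) atTop
        (𝓝 (toWeakSpace ℝ (TimeScaleFields V W ρ) v)) →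
      ∀ K : Set (Vec d), IsCompact K →
        TendstoUniformlyOn
          (fun n (p : unitInterval × Icc s₁ s₂ × Vec d) => flow (u n) p.1 p.2.1 p.2.2)
          (fun p => flow v p.1 p.2.1 p.2.2) atTop (univ ×ˢ univ ×ˢ K)) ∧
    -- existence of minimizers
    (∀ G : ((Icc s₁ s₂ × Vec d) →ᵤ[{K | IsCompact K}] Vec d) → ℝ,
      LowerSemicontinuousOn G (range (endMap (V := V) (W := W) (ρ := ρ))) →
      BddBelow (G '' range (endMap (V := V) (W := W) (ρ := ρ))) →
      ∃ v : TimeScaleFields V W ρ, ∀ w : TimeScaleFields V W ρ, objective G v ≤ objective G w) := by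
  refine ⟨fun v => ?_, fun u v hM hw K hK => ?_, fun G hG hb => ?_⟩
  · obtain ⟨φ, hφ⟩ := exists_isFlow v
    exact ⟨φ, hφ, fun ψ hψ => hψ.unique hφ⟩
  · obtain ⟨M, hM⟩ := hM
    exact tendstoUniformlyOn_flow hM (fun ℓ => ((WeakBilin.eval_continuous
      (topDualPairing ℝ (TimeScaleFields V W ρ)).flip ℓ).tendsto _).comp hw) hK
  · rw [← range_comp] at hb
    obtain ⟨v, hv⟩ := exists_minimizer_half_norm_sq_add hb fun l u v hM hw c hc => by
      obtain ⟨M, hM⟩ := hM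
      -- Lower semicontinuity of `G` is available only relative to the set of end maps, so the
      -- convergence is restricted to that set.
      have h1 := tendsto_nhdsWithin_of_tendsto_nhds_of_eventually_within _ (tendsto_endMap hM hw)
        (Eventually.of_forall fun n => mem_range_self (u n))
      exact h1.eventually (hG _ (mem_range_self v) c hc)
    refine ⟨v, fun w => ?_⟩
    simpa only [objective, ← Lp_norm_sq, Function.comp_apply] using hv w
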